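/- Let $S\subset\mathbb R^3$ be a surface, i.e. a Borel set with area $0<|S|<\infty$ that is covered, up to a set of zero area, by countably many regular $C^1$ patches (images of open subsets of the plane under $C^1$ immersions); this includes every nonempty compact embedded $C^1$ surface, with or without boundary, and every triangle mesh. Area is the two-dimensional Hausdorff measure $\mathcal H^2$, normalized to agree with Lebesgue measure on planes. A ray is an oriented line $\{p+td:t\in\mathbb R\}$ with $d\in S^2$ and $p\in d^\perp$; the space of rays carries the measure $d\ell=dp\,d\sigma(d)$, where $\sigma$ is the surface measure of $S^2$ and $dp$ is Lebesgue measure on $d^\perp$. Let $\mathbf L$ be a compact set of rays that contains all rays meeting $S$, let $\ell_1,\ell_2,\dots$ be independent random rays uniformly distributed in $\mathbf L$ with respect to $d\ell$, and let $k_i$ be the number of points of $\ell_i\cap S$. For every $M$ let $x_{M,1},x_{M,2},\dots$ be random points obtained as follows: given $\ell_1,\dots,\ell_M$ with $\sum_{i\le M}k_i>0$, rays are resampled independently with replacement from $\{\ell_1,\dots,\ell_M\}$, the ray $\ell_i$ with probability $k_i/\sum_{l\le M}k_l$, and $x_{M,j}$ is chosen uniformly at random, independently for different $j$, among the finitely many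 intersections of the $j$-th resampled ray with $S$. (With probability one all $k_i$ are finite and $\sum_{i\le M}k_i>0$ for all large $M$; for the remaining outcomes $x_{M,j}$ is arbitrary.) Then the points are asymptotically uniformly distributed (1-equidistributed) on $S$ in the following sense. 1. For every $j$ and every Borel set $B\subset\mathbb R^3$, $\mathbb P(x_{M,j}\in B)\to|B\cap S|/|S|$ as $M\to\infty$. 2. For every $f:\mathbb R^3\to\mathbb R$ that is integrable on $S$ with respect to area, the uniform-weight Monte Carlo estimator $$I_{M,N}=\frac1N\sum_{j=1}^N|S|\,f(x_{M,j})$$ is a consistent estimator of $\int_S f\,d\mathcal H^2$: it converges to $\int_S f\,d\mathcal H^2$ in probability as $M,N\to\infty$ jointly; and almost surely the limit $I_M=\lim_{N\to\infty}I_{M,N}$ exists for all sufficiently large $M$ and $I_M\to\int_S f\,d\mathcal H^2$ as $M\to\infty$. -/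

import Mathlib

open MeasureTheory ProbabilityTheory Filter Topology Metric
open scoped ENNReal RealInnerProductSpace

noncomputable section

/-- Euclidean three-space. -/
abbrev E3 : Type := EuclideanSpace ℝ (Fin 3)

/-- The space of rays, i.e. of oriented lines `{p + t d | t ∈ ℝ}` of `ℝ³`. A ray is given by its
unit direction `d` and the unique point `p` of the line that is orthogonal to `d`. The topology
and the (Borel) `σ`-algebra are those induced from `S² × ℝ³`. -/
abbrev Ray : Type := {q : sphere (0 : E3) 1 × E3 // ⟪(q.1 : E3), q.2⟫ = 0}

namespace Ray

/-- The unit direction of a ray. -/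
def dir (l : Ray) : E3 := l.1.1

/-- The point of the ray closest to the origin. -/
def base (l : Ray) : E3 := l.1.2

/-- The points of `ℝ³` on the ray. -/
def points (l : Ray) : Set E3 := {x | ∃ t : ℝ, x = l.base + t • l.dir}

/-- The ray with direction `d` through the point `p` of the plane `d^⊥`. -/
def ofPlane (d : sphere (0 : E3) 1) (p : (ℝ ∙ (d : E3))ᗮ) : Ray :=
  ⟨(d, (p : E3)), Submodule.mem_orthogonal_singleton_iff_inner_right.mp p.2⟩

lemma isClosed_range : IsClosed {q : sphere (0 : E3) 1 × E3 | ⟪(q.1 : E3), q.2⟫ = 0} :=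
  isClosed_eq (by fun_prop) continuous_const

instance : StandardBorelSpace Ray := isClosed_range.measurableSet.standardBorel

instance : Nonempty Ray :=
  ⟨⟨(⟨EuclideanSpace.single 0 1, by simp⟩, 0), inner_zero_right _⟩⟩

lemma measurable_ofPlane (d : sphere (0 : E3) 1) : Measurable (ofPlane d) :=
  Measurable.subtype_mk (measurable_const.prodMk measurable_subtype_coe)

/-- The plane of rays with direction `d`, with its Lebesgue measure. -/
def planeMeasure (d : sphere (0 : E3) 1) : Measure Ray :=
  (volume : Measure (ℝ ∙ (d : E3))ᗮ).map (ofPlane d)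

/-- The line through the point `x` with direction `d`. -/
def through (q : sphere (0 : E3) 1 × E3) : Ray :=
  ⟨(q.1, q.2 - ⟪(q.1 : E3), q.2⟫ • (q.1 : E3)), by
    simp [inner_sub_right, inner_smul_right]⟩

lemma measurable_through : Measurable through :=
  Continuous.measurable (by unfold through; fun_prop)

lemma planeMeasure_apply (d : sphere (0 : E3) 1) {A : Set Ray} (hA : MeasurableSet A) :
    planeMeasure d A =
      volume {x : E3 | ⟪(d : E3), x⟫ ∈ Set.Icc (0 : ℝ) 1 ∧ through (d, x) ∈ A} := by
  set K : Submodule ℝ E3 := ℝ ∙ (d : E3)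
  have hd : ‖(d : E3)‖ = 1 := by simp
  have he : MeasurePreserving (fun q : K × Kᗮ => (q.1 : E3) + (q.2 : E3)) := by
    have h1 : MeasurePreserving (WithLp.toLp 2 : K × Kᗮ → WithLp 2 (K × Kᗮ)) :=
      WithLp.volume_preserving_toLp _ _
    have h2 := K.orthogonalDecomposition.symm.measurePreserving.comp h1
    convert h2 using 1
    funext q
    simp
  have hm : MeasurableSet {x : E3 | ⟪(d : E3), x⟫ ∈ Set.Icc (0 : ℝ) 1 ∧ through (d, x) ∈ A} := by
    refine MeasurableSet.inter ?_ ((measurable_through.comp measurable_prodMk_left) hA)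
    exact (Continuous.measurable (by fun_prop)) measurableSet_Icc
  have hunit : volume {k : K | ⟪(d : E3), (k : E3)⟫ ∈ Set.Icc (0 : ℝ) 1} = 1 := by
    have h := (LinearIsometryEquiv.toSpanUnitSingleton (𝕜 := ℝ) (d : E3) hd).measurePreserving
    have hc : Continuous fun k : K => ⟪(d : E3), (k : E3)⟫ := by fun_prop
    have hmk : MeasurableSet {k : K | ⟪(d : E3), (k : E3)⟫ ∈ Set.Icc (0 : ℝ) 1} :=
      hc.measurable measurableSet_Icc
    rw [← h.measure_preimage hmk.nullMeasurableSet]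
    have : (LinearIsometryEquiv.toSpanUnitSingleton (𝕜 := ℝ) (d : E3) hd) ⁻¹'
        {k : K | ⟪(d : E3), (k : E3)⟫ ∈ Set.Icc (0 : ℝ) 1} = Set.Icc 0 1 := by
      ext t
      change ⟪(d : E3), t • (d : E3)⟫ ∈ Set.Icc (0 : ℝ) 1 ↔ _
      simp [inner_smul_right]
    rw [this]
    simp
  have hpre : (fun q : K × Kᗮ => (q.1 : E3) + (q.2 : E3)) ⁻¹'
      {x : E3 | ⟪(d : E3), x⟫ ∈ Set.Icc (0 : ℝ) 1 ∧ through (d, x) ∈ A} =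
      {k : K | ⟪(d : E3), (k : E3)⟫ ∈ Set.Icc (0 : ℝ) 1} ×ˢ (ofPlane d ⁻¹' A) := by
    ext ⟨⟨k, hk⟩, p⟩
    have hp : ⟪(d : E3), (p : E3)⟫ = 0 := Submodule.mem_orthogonal_singleton_iff_inner_right.mp p.2
    obtain ⟨t, rfl⟩ := Submodule.mem_span_singleton.mp hk
    have ht : through (d, t • (d : E3) + (p : E3)) = ofPlane d p := by
      apply Subtype.ext
      simp [through, ofPlane, inner_add_right, inner_smul_right, hp]
    simp [ht, inner_add_right, inner_smul_right, hp]
  rw [← he.measure_preimage hm.nullMeasurableSet, hpre, Measure.volume_eq_prod, Measure.prod_prod,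
    hunit, one_mul, planeMeasure, Measure.map_apply (measurable_ofPlane d) hA]

lemma measurable_planeMeasure : Measurable planeMeasure := by
  refine Measure.measurable_of_measurable_coe _ fun A hA => ?_
  simp_rw [planeMeasure_apply _ hA]
  have hm : MeasurableSet {q : sphere (0 : E3) 1 × E3 |
      ⟪(q.1 : E3), q.2⟫ ∈ Set.Icc (0 : ℝ) 1 ∧ through q ∈ A} := by
    refine MeasurableSet.inter ?_ (measurable_through hA)
    exact (Continuous.measurable (by fun_prop)) measurableSet_Icc
  exact measurable_measure_prodMk_left hm

/-- The motion-invariant measure `dℓ` on rays: the direction is distributed according to the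
surface measure of the unit sphere (of total mass `4π`) and, given the direction `d`, the ray
according to Lebesgue measure on the plane `d^⊥`. -/
def measure : Measure Ray := (volume : Measure E3).toSphere.bind planeMeasure

/-- The number `k(ℓ)` of intersections of the ray `ℓ` with the set `S`. (The value is `0` if there
are infinitely many; for a surface of finite area these rays form a null set.) -/
def numHits (S : Set E3) (l : Ray) : ℕ := (l.points ∩ S).ncard

end Ray

/-- Surface area in `ℝ³`: two-dimensional Hausdorff measure, normalized so that it agrees with
Lebesgue measure on planes. -/
def surfaceMeasure : Measure E3 := Measure.euclideanHausdorffMeasure 2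

/-- The area `|S|` of a set. -/
def area (S : Set E3) : ℝ := (surfaceMeasure S).toReal

/-- Surfaces in `ℝ³`, in the generality of rectifiable sets: Borel sets of positive finite area
that are covered, up to a set of zero area, by countably many regular `C¹` patches (immersed images
of open sets of the plane). This contains the nonempty compact embedded `C¹` surfaces, with or
without boundary, and the triangle meshes and other piecewise `C¹` or non-manifold surfaces. -/
structure IsSurface (S : Set E3) : Prop where
  measurableSet : MeasurableSet S
  area_pos : 0 < surfaceMeasure S
  area_lt_top : surfaceMeasure S < ∞
  exists_patches : ∃ (U : ℕ → Set (EuclideanSpace ℝ (Fin 2)))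
    (φ : ℕ → EuclideanSpace ℝ (Fin 2) → E3),
    (∀ n, IsOpen (U n) ∧ ContDiffOn ℝ 1 (φ n) (U n) ∧
      ∀ u ∈ U n, Function.Injective (fderiv ℝ (φ n) u)) ∧
    surfaceMeasure (S \ ⋃ n, φ n '' U n) = 0

/-- One step of the resampling procedure for given rays `r 0, …, r (M - 1)`: the joint law of the
resampled ray and the selected point. The ray `r i` is drawn with probability
`k(r i) / ∑ l, k(r l)`, and then a point is drawn uniformly from the finite set of intersections of
this ray with `S`. (It is a probability measure as soon as `∑ l, k(r l) ≠ 0`, and `0` otherwise.) -/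
def resampleLaw (S : Set E3) {M : ℕ} (r : Fin M → Ray) : Measure (Ray × E3) :=
  ∑ i, ((Ray.numHits S (r i) : ℝ≥0∞) / ∑ l, (Ray.numHits S (r l) : ℝ≥0∞)) •
    (Measure.dirac (r i)).prod (uniformOn ((r i).points ∩ S))

/-- The Monte Carlo estimator with uniform weights, `(1 / N) ∑_{j < N} |S| f(x_j)`. -/
def uniformEstimator (S : Set E3) (f : E3 → ℝ) (x : ℕ → E3) (N : ℕ) : ℝ :=
  (1 / (N : ℝ)) * ∑ j ∈ Finset.range N, area S * f (x j)

end

/-!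
The Cauchy–Crofton formula says that the counting measure of the intersections of `S` with a ray,
integrated over all rays, is a constant multiple of the area measure of `S`. It is proved by cutting
a compact subset of `S` into pieces that deviate from a plane by a small slope `ε`. A ray that is
steep with respect to this plane meets a piece at most once, so that for a fixed direction the
measure of the rays meeting the piece is the area of its projection; this area agrees with
`|⟪d, n⟫|` times the area of the piece up to an error controlled by `ε`. Averaging over the
directions removes the dependence on the normal `n`, by rotation invariance of the sphere, and
finally `ε` tends to zero.

The intersections of the first `M` rays with `S` form, after division by `M`, the empirical mean of
i.i.d. random measures whose expectation is thus proportional to the area measure of `S`; the strong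
law of large numbers applies to the integral of any fixed `f` against it. Given the rays, the points
are i.i.d. with the normalized pooled measure as their law. This yields the iterated limit by a
second application of the strong law; for the joint limit `f` is truncated, which makes the weak law
uniform in `M`.
-/

noncomputable section

section SigmaCompact

variable {X : Type*} [TopologicalSpace X] {A B : Set X}

lemma isSigmaCompact_inter [T2Space X] (hA : IsSigmaCompact A) (hB : IsSigmaCompact B) :
    IsSigmaCompact (A ∩ B) := by
  obtain ⟨K, hK, rfl⟩ := hA
  obtain ⟨L, hL, rfl⟩ := hB
  rw [Set.iUnion_inter_iUnion, ← Set.iUnion_prod' fun p : ℕ × ℕ => K p.1 ∩ L p.2]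
  exact isSigmaCompact_iUnion_of_isCompact _ fun p => (hK _).inter (hL _)

lemma isSigmaCompact_of_isLocallyClosed [LocallyCompactSpace X] [SecondCountableTopology X]
    (hA : IsLocallyClosed A) : IsSigmaCompact A :=
  have := hA.locallyCompactSpace
  isSigmaCompact_iff_sigmaCompactSpace.2 inferInstance

lemma measurableSet_of_isSigmaCompact [T2Space X] [MeasurableSpace X] [OpensMeasurableSpace X]
    (hA : IsSigmaCompact A) : MeasurableSet A := by
  obtain ⟨K, hK, rfl⟩ := hA
  exact .iUnion fun n => (hK n).measurableSet

end SigmaCompact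

section Hausdorff

open scoped NNReal

variable {X Y : Type*} [MetricSpace X] [MeasurableSpace X] [BorelSpace X]
  [MetricSpace Y] [MeasurableSpace Y] [BorelSpace Y] {f : X → Y} {s : Set X} {K : ℝ≥0} {d : ℕ}

lemma euclideanHausdorffMeasure_image_le_of_lipschitzOnWith (hf : LipschitzOnWith K f s) :
    μHE[d] (f '' s) ≤ (K : ℝ≥0∞) ^ d * μHE[d] s := by
  simp only [Measure.euclideanHausdorffMeasure_def, Measure.smul_apply]
  rw [mul_smul_comm]
  refine smul_le_smul_of_nonneg_left ?_ bot_le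
  simpa using hf.hausdorffMeasure_image_le (d := d) d.cast_nonneg

lemma euclideanHausdorffMeasure_le_of_antilipschitzWith_domRestrict
    (hf : AntilipschitzWith K (s.domRestrict f)) : μHE[d] s ≤ (K : ℝ≥0∞) ^ d * μHE[d] (f '' s) := by
  have hs : s = ((↑) : s → X) '' Set.univ := by simp
  have himage : f '' s = s.domRestrict f '' Set.univ := by
    rw [Set.image_univ, Set.range_domRestrict]
  conv_lhs => rw [hs]
  rw [himage, isometry_subtype_coe.euclideanHausdorffMeasure_image]
  simp only [Measure.euclideanHausdorffMeasure_def, Measure.smul_apply]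
  rw [mul_smul_comm]
  refine smul_le_smul_of_nonneg_left ?_ bot_le
  simpa using hf.le_hausdorffMeasure_image (d := d) d.cast_nonneg Set.univ

lemma euclideanHausdorffMeasure_eq_zero_iff :
    μHE[d] s = 0 ↔ (μH[d] : Measure X) s = 0 := by
  rw [Measure.euclideanHausdorffMeasure_def, Measure.smul_apply, ENNReal.smul_def, smul_eq_mul,
    mul_eq_zero, ENNReal.coe_eq_zero]
  exact or_iff_right (Measure.addHaarScalarFactor_volume_hausdorffMeasure_ne_zero d)

end Hausdorff

section Counting

variable {X : Type*} [MetricSpace X] [TopologicalSpace.SeparableSpace X] [Nonempty X]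

/-- The cells, indexed by `i`, of a partition of a separable metric space into sets of diameter at
most `2 / (m + 1)`: the closed balls of radius `1 / (m + 1)` around a dense sequence, made
disjoint. -/
def cell (m i : ℕ) : Set X :=
  disjointed (fun i => closedBall (TopologicalSpace.denseSeq X i) (1 / (m + 1 : ℝ))) i

lemma isLocallyClosed_cell (m i : ℕ) : IsLocallyClosed (cell m i : Set X) := by
  rw [cell, disjointed_apply, sdiff_eq]
  refine isClosed_closedBall.isLocallyClosed.inter (IsOpen.isLocallyClosed ?_)
  rw [isOpen_compl_iff, Finset.sup_set_eq_biUnion]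
  exact Set.Finite.isClosed_biUnion (Finset.finite_toSet _) fun _ _ => isClosed_closedBall

lemma iUnion_cell (m : ℕ) : ⋃ i, (cell m i : Set X) = Set.univ := by
  simp only [cell, iUnion_disjointed, Set.eq_univ_iff_forall, Set.mem_iUnion]
  intro x
  obtain ⟨i, hi⟩ := (TopologicalSpace.denseRange_denseSeq X).exists_dist_lt x
    (by positivity : (0 : ℝ) < 1 / (m + 1))
  exact ⟨i, hi.le⟩

lemma dist_le_of_mem_cell {m i : ℕ} {x y : X} (hx : x ∈ cell m i) (hy : y ∈ cell m i) :
    dist x y ≤ 2 / (m + 1 : ℝ) := by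
  have hx' := mem_closedBall.1 (disjointed_subset _ i hx)
  have hy' := mem_closedBall.1 (disjointed_subset _ i hy)
  calc dist x y ≤ 1 / (m + 1 : ℝ) + 1 / (m + 1 : ℝ) :=
        (dist_triangle_right _ _ _).trans (add_le_add hx' hy')
    _ = 2 / (m + 1 : ℝ) := by ring

/-- The number of cells of the `m`-th partition that meet `A`. -/
def cellCount (A : Set X) (m : ℕ) : ℝ≥0∞ :=
  ∑' i, ⨆ _ : (A ∩ cell m i).Nonempty, 1

lemma cellCount_mono {A B : Set X} (h : A ⊆ B) (m : ℕ) : cellCount A m ≤ cellCount B m :=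
  ENNReal.tsum_le_tsum fun _ =>
    iSup_const_mono fun hA => hA.mono (Set.inter_subset_inter_left _ h)

section Measure

variable [MeasurableSpace X] [OpensMeasurableSpace X]

lemma measurableSet_cell (m i : ℕ) : MeasurableSet (cell m i : Set X) :=
  .disjointed (fun _ => isClosed_closedBall.measurableSet) i

lemma tsum_measure_inter_cell (μ : Measure X) {A : Set X} (hA : MeasurableSet A) (m : ℕ) :
    ∑' i, μ (A ∩ cell m i) = μ A := by
  rw [← measure_iUnion, ← Set.inter_iUnion, iUnion_cell, Set.inter_univ]
  · exact fun i j hij => (disjoint_disjointed _ hij).mono Set.inter_subset_right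
      Set.inter_subset_right
  · exact fun i => hA.inter (measurableSet_cell m i)

lemma cellCount_le_count {A : Set X} (hA : MeasurableSet A) (m : ℕ) :
    cellCount A m ≤ Measure.count A := by
  rw [← tsum_measure_inter_cell Measure.count hA m]
  refine ENNReal.tsum_le_tsum fun i => iSup_le ?_
  rintro ⟨x, hx⟩
  calc 1 = Measure.count {x} := (Measure.count_singleton x).symm
    _ ≤ Measure.count (A ∩ cell m i) := measure_mono (Set.singleton_subset_iff.2 hx)

lemma eventually_count_le_cellCount {T : Set X} (hT : T.Finite) :
    ∀ᶠ m in atTop, Measure.count T ≤ cellCount T m := by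
  have hlim : Tendsto (fun m : ℕ => 2 / (m + 1 : ℝ)) atTop (𝓝 0) := by
    simpa [div_eq_mul_inv] using tendsto_one_div_add_atTop_nhds_zero_nat.const_mul (2 : ℝ)
  have hsep : ∀ᶠ m : ℕ in atTop, ∀ x ∈ T, ∀ y ∈ T, x ≠ y → 2 / (m + 1 : ℝ) < dist x y := by
    refine (eventually_all_finite hT).2 fun x _ => (eventually_all_finite hT).2 fun y _ => ?_
    by_cases hxy : x = y
    · simp [hxy]
    · filter_upwards [hlim.eventually_lt_const (dist_pos.2 hxy)] with m hm _ using hm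
  filter_upwards [hsep] with m hm
  rw [← tsum_measure_inter_cell Measure.count hT.measurableSet m]
  refine ENNReal.tsum_le_tsum fun i => ?_
  rcases (T ∩ cell m i).eq_empty_or_nonempty with h | ⟨x, hx⟩
  · simp [h]
  · have hsub : (T ∩ cell m i).Subsingleton := fun y hy z hz => by
      by_contra hyz
      exact (hm y hy.1 z hz.1 hyz).not_ge (dist_le_of_mem_cell hy.2 hz.2)
    rw [hsub.eq_singleton_of_mem hx, Measure.count_singleton]
    exact le_iSup_of_le (Set.singleton_nonempty x) le_rfl

lemma count_eq_liminf_cellCount {A : Set X} (hA : MeasurableSet A) :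
    Measure.count A = liminf (cellCount A) atTop := by
  refine le_antisymm (le_of_forall_lt fun a ha => ?_)
    (liminf_le_of_frequently_le' (.of_forall (cellCount_le_count hA)))
  obtain ⟨T, hTfin, hTA, haT⟩ : ∃ T : Set X, T.Finite ∧ T ⊆ A ∧ a < Measure.count T := by
    by_cases hfin : A.Finite
    · exact ⟨A, hfin, subset_rfl, ha⟩
    · obtain ⟨n, hn⟩ := ENNReal.exists_nat_gt ha.ne_top
      obtain ⟨T, hT, rfl⟩ := Set.Infinite.exists_subset_card_eq hfin n
      exact ⟨T, T.finite_toSet, hT, by rwa [Measure.count_apply_finset]⟩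
  refine haT.trans_le (le_liminf_of_le (by isBoundedDefault) ?_)
  filter_upwards [eventually_count_le_cellCount hTfin] with m hm
  exact hm.trans (cellCount_mono hTA m)

end Measure

end Counting

section FlatSets

open Module

variable {E : Type*} [NormedAddCommGroup E] [InnerProductSpace ℝ E] {n v : E}

/-- A set all of whose chords make an angle of sine at most `ε` with the hyperplane `n^⊥`, for a
unit vector `n`. -/
def IsFlat (ε : ℝ) (n : E) (K : Set E) : Prop :=
  ∀ x ∈ K, ∀ y ∈ K, |⟪n, x - y⟫| ≤ ε * ‖x - y‖

lemma IsFlat.mono {ε δ : ℝ} {A B : Set E} (h : IsFlat ε n B) (hAB : A ⊆ B) (hεδ : ε ≤ δ) :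
    IsFlat δ n A := fun x hx y hy =>
  (h x (hAB hx) y (hAB hy)).trans (mul_le_mul_of_nonneg_right hεδ (norm_nonneg _))

lemma IsFlat.subsingleton_inter_line {ε : ℝ} {K L : Set E} (h : IsFlat ε n K) (hv : ‖v‖ = 1)
    (hε : ε < |⟪n, v⟫|) (hL : ∀ x ∈ L, ∀ y ∈ L, ∃ t : ℝ, x - y = t • v) :
    (L ∩ K).Subsingleton := by
  rintro x ⟨hxL, hxK⟩ y ⟨hyL, hyK⟩
  obtain ⟨t, ht⟩ := hL x hxL y hyL
  have hflat := h x hxK y hyK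
  rw [ht, inner_smul_right, norm_smul, hv, mul_one, abs_mul, Real.norm_eq_abs, mul_comm] at hflat
  have ht0 : |t| = 0 := by
    by_contra hne
    exact hε.not_ge (le_of_mul_le_mul_right hflat ((abs_nonneg t).lt_of_ne' hne))
  rwa [abs_eq_zero.1 ht0, zero_smul, sub_eq_zero] at ht

/-- The projection to the hyperplane `n^⊥` along the direction `v`; it degenerates to the identity
when `v ∈ n^⊥`. -/
def obliqueProjection (n v x : E) : E := x - (⟪n, x⟫ / ⟪n, v⟫) • v

lemma inner_obliqueProjection (hnv : ⟪n, v⟫ ≠ 0) (x : E) : ⟪n, obliqueProjection n v x⟫ = 0 := by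
  rw [obliqueProjection, inner_sub_right, inner_smul_right, div_mul_cancel₀ _ hnv, sub_self]

lemma starProjection_obliqueProjection (n v x : E) :
    (ℝ ∙ v)ᗮ.starProjection (obliqueProjection n v x) = (ℝ ∙ v)ᗮ.starProjection x := by
  have hv : (ℝ ∙ v)ᗮ.starProjection v = 0 :=
    (Submodule.starProjection_apply_eq_zero_iff _).2
      (Submodule.le_orthogonal_orthogonal _ (Submodule.mem_span_singleton_self v))
  rw [obliqueProjection, map_sub, map_smul, hv, smul_zero, sub_zero]

lemma IsFlat.norm_obliqueProjection_sub_le {η : ℝ} {K : Set E}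
    (h : IsFlat (η * |⟪n, v⟫|) n K) (hv : ‖v‖ = 1) (hnv : ⟪n, v⟫ ≠ 0) {x y : E} (hx : x ∈ K)
    (hy : y ∈ K) :
    ‖(x - y) - (obliqueProjection n v x - obliqueProjection n v y)‖ ≤ η * ‖x - y‖ := by
  have heq : (x - y) - (obliqueProjection n v x - obliqueProjection n v y) =
      (⟪n, x - y⟫ / ⟪n, v⟫) • v := by
    simp only [obliqueProjection, inner_sub_right]
    module
  rw [heq, norm_smul, hv, mul_one, Real.norm_eq_abs, abs_div, div_le_iff₀ (abs_pos.2 hnv),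
    mul_right_comm]
  exact h x hx y hy

lemma IsFlat.lipschitzOnWith_obliqueProjection {η : ℝ} (hη : 0 ≤ η) {K : Set E}
    (h : IsFlat (η * |⟪n, v⟫|) n K) (hv : ‖v‖ = 1) (hnv : ⟪n, v⟫ ≠ 0) :
    LipschitzOnWith (1 + η).toNNReal (obliqueProjection n v) K := by
  refine LipschitzOnWith.of_dist_le_mul fun x hx y hy => ?_
  rw [Real.coe_toNNReal _ (by positivity), dist_eq_norm, dist_eq_norm, add_mul, one_mul]
  exact (norm_le_norm_add_norm_sub _ _).trans
    (add_le_add_right (h.norm_obliqueProjection_sub_le hv hnv hx hy) _)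

lemma IsFlat.antilipschitzWith_obliqueProjection {η : ℝ} (hη : η < 1) {K : Set E}
    (h : IsFlat (η * |⟪n, v⟫|) n K) (hv : ‖v‖ = 1) (hnv : ⟪n, v⟫ ≠ 0) :
    AntilipschitzWith (1 - η)⁻¹.toNNReal (K.domRestrict (obliqueProjection n v)) := by
  refine AntilipschitzWith.of_le_mul_dist fun x y => ?_
  have hη' : 0 < 1 - η := sub_pos.2 hη
  rw [Real.coe_toNNReal _ (inv_nonneg.2 hη'.le), inv_mul_eq_div, le_div_iff₀ hη', Subtype.dist_eq,
    dist_eq_norm, dist_eq_norm, Set.domRestrict_apply, Set.domRestrict_apply]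
  have hdiff := h.norm_obliqueProjection_sub_le hv hnv x.2 y.2
  have htriangle := norm_le_norm_add_norm_sub'
    ((x : E) - y) (obliqueProjection n v x - obliqueProjection n v y)
  linarith

lemma starProjection_orthogonal_unit (hv : ‖v‖ = 1) (x : E) :
    (ℝ ∙ v)ᗮ.starProjection x = x - ⟪v, x⟫ • v := by
  rw [Submodule.starProjection_orthogonal_val, Submodule.starProjection_unit_singleton ℝ hv]

section FiniteDimensional

variable [FiniteDimensional ℝ E]

lemma normDet_starProjection_comp_subtype (hn : ‖n‖ = 1) (hv : ‖v‖ = 1) :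
    ((ℝ ∙ v)ᗮ.starProjection.toLinearMap ∘ₗ (ℝ ∙ n)ᗮ.subtype).normDet = |⟪n, v⟫| := by
  set P := (ℝ ∙ v)ᗮ.starProjection.toLinearMap ∘ₗ (ℝ ∙ n)ᗮ.subtype
  set w := (ℝ ∙ n)ᗮ.orthogonalProjectionOnto v
  have hP (x : (ℝ ∙ n)ᗮ) : P x = (x : E) - ⟪v, (x : E)⟫ • v :=
    starProjection_orthogonal_unit hv x
  have hw (x : (ℝ ∙ n)ᗮ) : ⟪w, x⟫ = ⟪v, (x : E)⟫ :=
    Submodule.inner_orthogonalProjectionOnto_eq_of_mem_right x v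
  have hadjoint : P.adjoint ∘ₗ P = LinearMap.transvection (-innerₗ _ w) w := by
    refine LinearMap.ext fun x => ext_inner_right ℝ fun y => ?_
    rw [LinearMap.comp_apply, LinearMap.adjoint_inner_left, hP, hP, LinearMap.transvection.apply]
    simp only [inner_sub_left, inner_sub_right, inner_add_left, inner_smul_left, inner_smul_right,
      inner_neg_left, LinearMap.neg_apply, innerₗ_apply_apply, neg_smul, Submodule.coe_inner, hw,
      real_inner_self_eq_norm_sq, hv, real_inner_comm v (x : E), Real.ringHom_apply]
    ring
  have hww : ⟪w, w⟫ = 1 - ⟪n, v⟫ ^ 2 := by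
    have hwE : (w : E) = v - ⟪n, v⟫ • n := starProjection_orthogonal_unit hn v
    rw [hw, hwE, inner_sub_right, inner_smul_right, real_inner_self_eq_norm_sq, hv,
      real_inner_comm n v]
    ring
  rw [← abs_of_nonneg P.normDet_nonneg, ← sq_eq_sq_iff_abs_eq_abs]
  have h := P.normDet_sq
  rw [hadjoint, LinearMap.transvection.det, LinearMap.neg_apply, innerₗ_apply_apply, hww] at h
  simpa using h

variable [MeasurableSpace E] [BorelSpace E] {d : ℕ}

lemma euclideanHausdorffMeasure_starProjection_image_of_subset_orthogonal
    (hd : finrank ℝ E = d + 1) (hn : ‖n‖ = 1) (hv : ‖v‖ = 1) {B : Set E}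
    (hB : ∀ x ∈ B, ⟪n, x⟫ = 0) :
    μHE[d] ((ℝ ∙ v)ᗮ.starProjection '' B) = ENNReal.ofReal |⟪n, v⟫| * μHE[d] B := by
  have : Fact (finrank ℝ E = d + 1) := ⟨hd⟩
  have hrank : finrank ℝ (ℝ ∙ n)ᗮ = d :=
    Submodule.finrank_orthogonal_span_singleton (norm_ne_zero_iff.1 (hn ▸ one_ne_zero))
  obtain ⟨B', rfl⟩ : ∃ B' : Set (ℝ ∙ n)ᗮ, (ℝ ∙ n)ᗮ.subtype '' B' = B :=
    Set.subset_range_iff_exists_image_eq.1 fun x hx =>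
      ⟨⟨x, Submodule.mem_orthogonal_singleton_iff_inner_right.2 (hB x hx)⟩, rfl⟩
  have himage := LinearMap.euclideanHausdorffMeasure_image
    ((ℝ ∙ v)ᗮ.starProjection.toLinearMap ∘ₗ (ℝ ∙ n)ᗮ.subtype) B'
  rw [hrank, normDet_starProjection_comp_subtype hn hv] at himage
  have hisometry : μHE[d] ((ℝ ∙ n)ᗮ.subtype '' B') = μHE[d] B' :=
    isometry_subtype_coe.euclideanHausdorffMeasure_image B'
  rwa [LinearMap.coe_comp, Set.image_comp, ← hisometry] at himage

lemma euclideanHausdorffMeasure_starProjection_image_eq_obliqueProjection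
    (hd : finrank ℝ E = d + 1) (hn : ‖n‖ = 1) (hv : ‖v‖ = 1) (hnv : ⟪n, v⟫ ≠ 0) (K : Set E) :
    μHE[d] ((ℝ ∙ v)ᗮ.starProjection '' K) =
      ENNReal.ofReal |⟪n, v⟫| * μHE[d] (obliqueProjection n v '' K) := by
  rw [← euclideanHausdorffMeasure_starProjection_image_of_subset_orthogonal hd hn hv
    (Set.forall_mem_image.2 fun x _ => inner_obliqueProjection hnv x), Set.image_image]
  simp_rw [starProjection_obliqueProjection]

lemma IsFlat.euclideanHausdorffMeasure_starProjection_image_le {η : ℝ} (hη : 0 ≤ η) {K : Set E}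
    (h : IsFlat (η * |⟪n, v⟫|) n K) (hd : finrank ℝ E = d + 1)
    (hn : ‖n‖ = 1) (hv : ‖v‖ = 1) (hnv : ⟪n, v⟫ ≠ 0) :
    μHE[d] ((ℝ ∙ v)ᗮ.starProjection '' K) ≤
      ENNReal.ofReal ((1 + η) ^ d * |⟪n, v⟫|) * μHE[d] K := by
  rw [euclideanHausdorffMeasure_starProjection_image_eq_obliqueProjection hd hn hv hnv,
    mul_comm ((1 + η) ^ d), ENNReal.ofReal_mul (abs_nonneg _), ENNReal.ofReal_pow (by positivity),
    mul_assoc]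
  gcongr
  exact euclideanHausdorffMeasure_image_le_of_lipschitzOnWith
    (h.lipschitzOnWith_obliqueProjection hη hv hnv)

lemma IsFlat.le_euclideanHausdorffMeasure_starProjection_image {η : ℝ} (hη : η < 1) {K : Set E}
    (h : IsFlat (η * |⟪n, v⟫|) n K) (hd : finrank ℝ E = d + 1)
    (hn : ‖n‖ = 1) (hv : ‖v‖ = 1) (hnv : ⟪n, v⟫ ≠ 0) :
    ENNReal.ofReal ((1 - η) ^ d * |⟪n, v⟫|) * μHE[d] K ≤
      μHE[d] ((ℝ ∙ v)ᗮ.starProjection '' K) := by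
  have : 0 < 1 - η := sub_pos.2 hη
  rw [euclideanHausdorffMeasure_starProjection_image_eq_obliqueProjection hd hn hv hnv]
  calc ENNReal.ofReal ((1 - η) ^ d * |⟪n, v⟫|) * μHE[d] K
      ≤ ENNReal.ofReal ((1 - η) ^ d * |⟪n, v⟫|) *
          (ENNReal.ofReal (1 - η)⁻¹ ^ d * μHE[d] (obliqueProjection n v '' K)) := by
        gcongr
        exact euclideanHausdorffMeasure_le_of_antilipschitzWith_domRestrict
          (h.antilipschitzWith_obliqueProjection hη hv hnv)
    _ = ENNReal.ofReal |⟪n, v⟫| * μHE[d] (obliqueProjection n v '' K) := by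
        rw [← mul_assoc, ← ENNReal.ofReal_pow (by positivity), ← ENNReal.ofReal_mul (by positivity),
          inv_pow, mul_right_comm, mul_inv_cancel₀ (by positivity), one_mul]

end FiniteDimensional

end FlatSets

section Patches

open Module

variable {E F : Type*} [NormedAddCommGroup E] [InnerProductSpace ℝ E] [NormedAddCommGroup F]
  [NormedSpace ℝ F] {φ : F → E} {ε : ℝ}

lemma exists_nhds_isFlat_image_of_hasStrictFDerivAt {A : F →L[ℝ] E} {u : F}
    (hφ : HasStrictFDerivAt φ A u) {k : NNReal} (hA : AntilipschitzWith k A) {n : E}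
    (hn : ∀ w, ⟪n, A w⟫ = 0) (hε : 0 < ε) :
    ∃ V ∈ 𝓝 u, IsFlat ε n (φ '' V) := by
  have hsmall : (fun p : F × F => ⟪n, φ p.1 - φ p.2⟫) =o[𝓝 (u, u)]
      fun p : F × F => φ p.1 - φ p.2 := by
    have hinner : (fun p : F × F => ⟪n, φ p.1 - φ p.2 - A (p.1 - p.2)⟫) =O[𝓝 (u, u)]
        fun p : F × F => φ p.1 - φ p.2 - A (p.1 - p.2) :=
      (innerSL ℝ n).isBigO_comp _ _
    simp_rw [inner_sub_right n _ (A _), hn, sub_zero] at hinner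
    exact (hinner.trans_isLittleO hφ.isLittleO).trans_isBigO
      (hφ.isTheta_sub (hA.isUniformInducing A.uniformContinuous).isInducing).isBigO_symm
  obtain ⟨V, hV, hVsub⟩ := mem_prod_same_iff.1 (nhds_prod_eq (x := u) (y := u) ▸ hsmall.bound hε)
  refine ⟨V, hV, ?_⟩
  rintro _ ⟨x, hx, rfl⟩ _ ⟨y, hy, rfl⟩
  exact hVsub (Set.mk_mem_prod hx hy)

variable [FiniteDimensional ℝ F]

lemma exists_norm_eq_one_forall_inner_eq_zero (A : F →ₗ[ℝ] E) (h : finrank ℝ F < finrank ℝ E) :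
    ∃ n : E, ‖n‖ = 1 ∧ ∀ w, ⟪n, A w⟫ = 0 := by
  have hrange : A.range ≠ ⊤ := fun htop =>
    (A.finrank_range_le.trans_lt h).ne (by rw [htop, finrank_top])
  obtain ⟨v, hv, hv0⟩ := Submodule.exists_mem_ne_zero_of_ne_bot
    (mt Submodule.orthogonal_eq_bot_iff.1 hrange)
  refine ⟨(‖v‖⁻¹ : ℝ) • v, norm_smul_inv_norm hv0, fun w => ?_⟩
  rw [inner_smul_left, (Submodule.mem_orthogonal' _ _).1 hv (A w) ⟨w, rfl⟩, mul_zero]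

lemma exists_countable_isCompact_isFlat_cover_image {U : Set F} (hU : IsOpen U)
    (hφ : ContDiffOn ℝ 1 φ U) (hinj : ∀ u ∈ U, Function.Injective (fderiv ℝ φ u))
    (hrank : finrank ℝ F < finrank ℝ E) (hε : 0 < ε) :
    ∃ 𝒦 : Set (Set E), 𝒦.Countable ∧
      (∀ K ∈ 𝒦, IsCompact K ∧ ∃ n : E, ‖n‖ = 1 ∧ IsFlat ε n K) ∧ φ '' U ⊆ ⋃₀ 𝒦 := by
  have hlocal : ∀ u ∈ U, ∃ V ∈ 𝓝 u,
      IsCompact (φ '' V) ∧ ∃ n : E, ‖n‖ = 1 ∧ IsFlat ε n (φ '' V) := by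
    intro u hu
    have hstrict := (hφ.contDiffAt (hU.mem_nhds hu)).hasStrictFDerivAt one_ne_zero
    obtain ⟨k, -, hk⟩ := LinearMap.exists_antilipschitzWith (fderiv ℝ φ u).toLinearMap
      (LinearMap.ker_eq_bot.2 (hinj u hu))
    obtain ⟨n, hn, hnA⟩ := exists_norm_eq_one_forall_inner_eq_zero (fderiv ℝ φ u).toLinearMap hrank
    obtain ⟨V, hV, hflat⟩ := exists_nhds_isFlat_image_of_hasStrictFDerivAt hstrict hk hnA hε
    have : ProperSpace F := FiniteDimensional.proper ℝ F
    obtain ⟨r, hr, hball⟩ := nhds_basis_closedBall.mem_iff.1 (inter_mem hV (hU.mem_nhds hu))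
    exact ⟨closedBall u r, closedBall_mem_nhds u hr,
      (isCompact_closedBall u r).image_of_continuousOn
        (hφ.continuousOn.mono (hball.trans Set.inter_subset_right)), n, hn,
      hflat.mono (Set.image_mono (hball.trans Set.inter_subset_left)) le_rfl⟩
  choose! V hV hcompact hflat using hlocal
  obtain ⟨t, htU, ht, hUt⟩ := TopologicalSpace.countable_cover_nhdsWithin
    fun u hu => mem_nhdsWithin_of_mem_nhds (hV u hu)
  refine ⟨(fun u => φ '' V u) '' t, ht.image _, ?_, ?_⟩
  · rintro _ ⟨u, hu, rfl⟩
    exact ⟨hcompact u (htU hu), hflat u (htU hu)⟩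
  · rw [Set.sUnion_image, ← Set.image_iUnion₂]
    exact Set.image_mono hUt

end Patches

lemma IsSurface.exists_countable_isCompact_isFlat_cover {S : Set E3} (hS : IsSurface S) {ε : ℝ}
    (hε : 0 < ε) :
    ∃ 𝒦 : Set (Set E3), 𝒦.Countable ∧
      (∀ K ∈ 𝒦, IsCompact K ∧ ∃ n : E3, ‖n‖ = 1 ∧ IsFlat ε n K) ∧
      surfaceMeasure (S \ ⋃₀ 𝒦) = 0 := by
  obtain ⟨U, φ, hUφ, hnull⟩ := hS.exists_patches
  choose 𝒦 hcount hflat hcover using fun m =>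
    exists_countable_isCompact_isFlat_cover_image (hUφ m).1 (hUφ m).2.1 (hUφ m).2.2 (by simp) hε
  refine ⟨⋃ m, 𝒦 m, Set.countable_iUnion hcount, ?_, measure_mono_null ?_ hnull⟩
  · simpa only [Set.mem_iUnion, forall_exists_index] using fun K m => hflat m K
  · rw [Set.sUnion_iUnion]
    exact Set.sdiff_subset_sdiff_right (Set.iUnion_mono hcover)

section Sphere

variable {E : Type*} [NormedAddCommGroup E] [InnerProductSpace ℝ E]

lemma inner_self_sphere (n : sphere (0 : E) 1) : ⟪(n : E), (n : E)⟫ = 1 := by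
  rw [real_inner_self_eq_norm_sq, norm_eq_of_mem_sphere, one_pow]

/-- The action of a linear isometry on the unit sphere. -/
def sphereMap (R : E ≃ₗᵢ[ℝ] E) (d : sphere (0 : E) 1) : sphere (0 : E) 1 :=
  ⟨R d, by simp⟩

lemma continuous_sphereMap (R : E ≃ₗᵢ[ℝ] E) : Continuous (sphereMap R) := by
  unfold sphereMap; fun_prop

/-- The directions `d` with `|⟪n, d⟫| < η`, a band around the equator orthogonal to `n`. -/
def band (n : sphere (0 : E) 1) (η : ℝ) : Set (sphere (0 : E) 1) :=
  {d | |⟪(n : E), (d : E)⟫| < η}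

variable [MeasurableSpace E] [BorelSpace E]

lemma measurableSet_band (n : sphere (0 : E) 1) (η : ℝ) : MeasurableSet (band n η) :=
  (isOpen_lt (by fun_prop) continuous_const).measurableSet

variable [FiniteDimensional ℝ E]

open scoped Pointwise in
lemma measurePreserving_sphereMap (R : E ≃ₗᵢ[ℝ] E) :
    MeasurePreserving (sphereMap R) (volume : Measure E).toSphere
      (volume : Measure E).toSphere := by
  refine ⟨(continuous_sphereMap R).measurable, Measure.ext fun s hs => ?_⟩
  have hcone : Set.Ioo (0 : ℝ) 1 • ((↑) '' (sphereMap R ⁻¹' s) : Set E) =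
      R ⁻¹' (Set.Ioo (0 : ℝ) 1 • ((↑) '' s : Set E)) := by
    ext x
    simp only [Set.mem_smul, Set.mem_image, Set.mem_preimage]
    constructor
    · rintro ⟨t, ht, _, ⟨d, hd, rfl⟩, rfl⟩
      exact ⟨t, ht, _, ⟨sphereMap R d, hd, rfl⟩, by simp [sphereMap]⟩
    · rintro ⟨t, ht, _, ⟨d, hd, rfl⟩, h⟩
      have hinv : sphereMap R (sphereMap R.symm d) = d := Subtype.ext (by simp [sphereMap])
      exact ⟨t, ht, _, ⟨sphereMap R.symm d, hinv.symm ▸ hd, rfl⟩,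
        R.injective (by simp [sphereMap, h])⟩
  rw [Measure.map_apply (continuous_sphereMap R).measurable hs, Measure.toSphere_apply' _ hs,
    Measure.toSphere_apply' _ ((continuous_sphereMap R).measurable hs), hcone]
  congr 1
  exact R.measurePreserving.measure_preimage_equiv (f := R.toHomeomorph.toMeasurableEquiv) _

lemma lintegral_toSphere_inner_eq (n n' : sphere (0 : E) 1) {h : ℝ → ℝ≥0∞} (hh : Measurable h) :
    ∫⁻ d, h ⟪(n : E), (d : E)⟫ ∂(volume : Measure E).toSphere =
      ∫⁻ d, h ⟪(n' : E), (d : E)⟫ ∂(volume : Measure E).toSphere := by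
  let R : E ≃ₗᵢ[ℝ] E := (ℝ ∙ ((n : E) - n'))ᗮ.reflection
  have hR : R n = n' := Submodule.reflection_sub (by simp)
  have hm : Measurable fun d : sphere (0 : E) 1 => h ⟪(n' : E), (d : E)⟫ :=
    hh.comp (Continuous.measurable (by fun_prop))
  rw [← (measurePreserving_sphereMap R).lintegral_comp hm]
  refine lintegral_congr fun d => ?_
  rw [← hR, sphereMap, R.inner_map_map]

lemma toSphere_band_eq (n n' : sphere (0 : E) 1) (η : ℝ) :
    (volume : Measure E).toSphere (band n η) = (volume : Measure E).toSphere (band n' η) := by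
  rw [← lintegral_indicator_one (measurableSet_band n η),
    ← lintegral_indicator_one (measurableSet_band n' η)]
  exact lintegral_toSphere_inner_eq n n' (h := {t | |t| < η}.indicator 1)
    (measurable_one.indicator (isOpen_lt (by fun_prop) continuous_const).measurableSet)

lemma toSphere_equator (n : sphere (0 : E) 1) :
    (volume : Measure E).toSphere {d | ⟪(n : E), (d : E)⟫ = 0} = 0 := by
  rw [Measure.toSphere_apply' _ (isClosed_eq (by fun_prop) continuous_const).measurableSet]
  refine mul_eq_zero_of_right _ (measure_mono_null (t := ((ℝ ∙ (n : E))ᗮ : Set E)) ?_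
    (Measure.addHaar_submodule _ _ fun htop => ?_))
  · rintro _ ⟨t, -, _, ⟨d, hd : ⟪(n : E), (d : E)⟫ = 0, rfl⟩, rfl⟩
    rw [SetLike.mem_coe, Submodule.mem_orthogonal_singleton_iff_inner_right]
    exact (inner_smul_right _ _ _).trans (by rw [hd, mul_zero])
  · have hn : (n : E) ∈ (ℝ ∙ (n : E))ᗮ := htop ▸ Submodule.mem_top
    rw [Submodule.mem_orthogonal_singleton_iff_inner_right, inner_self_sphere] at hn
    exact one_ne_zero hn

lemma tendsto_toSphere_band (n : sphere (0 : E) 1) :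
    Tendsto (fun η => (volume : Measure E).toSphere (band n η)) (𝓝[>] 0) (𝓝 0) := by
  have hinter : ⋂ η > (0 : ℝ), band n η = {d : sphere (0 : E) 1 | ⟪(n : E), (d : E)⟫ = 0} := by
    ext d
    simp only [band, Set.mem_iInter, Set.mem_ofPred_eq]
    exact ⟨fun h => by_contra fun hne => lt_irrefl _ (h _ (abs_pos.2 hne)),
      fun h η hη => by simpa [h] using hη⟩
  rw [← toSphere_equator n, ← hinter]
  exact tendsto_measure_biInter_gt (fun η _ => (measurableSet_band n η).nullMeasurableSet)
    (fun _ _ _ hij _ hd => lt_of_lt_of_le hd hij) ⟨1, one_pos, measure_ne_top _ _⟩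

end Sphere

/-- A reference direction; by rotation invariance its choice is immaterial. -/
def pole : sphere (0 : E3) 1 := ⟨EuclideanSpace.single 0 1, by simp⟩

/-- The constant `∫_{S²} |⟪n, d⟫| dσ(d)` of the Cauchy–Crofton formula, which does not depend on
the unit vector `n`. -/
def croftonConst : ℝ≥0∞ :=
  ∫⁻ d, ENNReal.ofReal |⟪(pole : E3), (d : E3)⟫| ∂(volume : Measure E3).toSphere

lemma lintegral_abs_inner_toSphere (n : sphere (0 : E3) 1) :
    ∫⁻ d, ENNReal.ofReal |⟪(n : E3), (d : E3)⟫| ∂(volume : Measure E3).toSphere = croftonConst :=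
  lintegral_toSphere_inner_eq n pole (h := fun t => ENNReal.ofReal |t|) (by fun_prop)

lemma croftonConst_ne_top : croftonConst ≠ ∞ := by
  refine ne_top_of_le_ne_top (measure_ne_top (volume : Measure E3).toSphere Set.univ) ?_
  rw [← lintegral_one]
  refine lintegral_mono fun d => ENNReal.ofReal_le_one.2 ?_
  simpa using abs_real_inner_le_norm (pole : E3) (d : E3)

lemma croftonConst_ne_zero : croftonConst ≠ 0 := by
  have hc : Continuous fun d : sphere (0 : E3) 1 => ENNReal.ofReal |⟪(pole : E3), (d : E3)⟫| :=
    ENNReal.continuous_ofReal.comp (by fun_prop)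
  rw [croftonConst, ← pos_iff_ne_zero, lintegral_pos_iff_support hc.measurable]
  refine hc.isOpen_support.measure_pos _ ⟨pole, ?_⟩
  rw [Function.mem_support, inner_self_sphere]
  simp

namespace Ray

/-- The rays that meet the set `B`. -/
def hits (B : Set E3) : Set Ray := {l | (l.points ∩ B).Nonempty}

/-- The number of points of `B` on a ray. Unlike `numHits`, it is infinite, not zero, on the rays
with infinitely many such points. -/
def hitCount (B : Set E3) (l : Ray) : ℝ≥0∞ := Measure.count (l.points ∩ B)

lemma mem_points_iff {l : Ray} {x : E3} : x ∈ l.points ↔ through (l.1.1, x) = l := by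
  have hdir : ⟪l.dir, l.dir⟫ = 1 := inner_self_sphere l.1.1
  have hbase : ⟪l.dir, l.base⟫ = 0 := l.2
  constructor
  · rintro ⟨t, rfl⟩
    refine Subtype.ext (Prod.ext rfl ?_)
    change l.base + t • l.dir - ⟪l.dir, l.base + t • l.dir⟫ • l.dir = l.base
    rw [inner_add_right, inner_smul_right, hdir, hbase, zero_add, mul_one, add_sub_cancel_right]
  · intro h
    have : x - ⟪l.dir, x⟫ • l.dir = l.base := congrArg base h
    exact ⟨⟪l.dir, x⟫, by rw [← this, sub_add_cancel]⟩

lemma exists_sub_eq_smul_dir {l : Ray} {x y : E3} (hx : x ∈ l.points) (hy : y ∈ l.points) :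
    ∃ t : ℝ, x - y = t • l.dir := by
  obtain ⟨s, rfl⟩ := hx
  obtain ⟨t, rfl⟩ := hy
  exact ⟨s - t, by rw [add_sub_add_left_eq_sub, sub_smul]⟩

lemma continuous_through : Continuous through := by unfold through; fun_prop

lemma measurableSet_points (l : Ray) : MeasurableSet l.points := by
  have heq : l.points = {x | through (l.1.1, x) = l} := Set.ext fun _ => mem_points_iff
  exact heq ▸ (isClosed_eq (continuous_through.comp (by fun_prop)) continuous_const).measurableSet

lemma hits_eq_image (B : Set E3) : hits B = through '' (Prod.snd ⁻¹' B) := by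
  ext l
  constructor
  · rintro ⟨x, hx, hB⟩
    exact ⟨(l.1.1, x), hB, mem_points_iff.1 hx⟩
  · rintro ⟨q, hB, rfl⟩
    exact ⟨q.2, mem_points_iff.2 rfl, hB⟩

lemma hits_mono {A B : Set E3} (h : A ⊆ B) : hits A ⊆ hits B :=
  fun _ hl => hl.mono (Set.inter_subset_inter_right _ h)

lemma isCompact_hits {K : Set E3} (hK : IsCompact K) : IsCompact (hits K) := by
  rw [hits_eq_image, ← Set.univ_prod]
  exact (isCompact_univ.prod hK).image continuous_through

lemma measurableSet_hits {B : Set E3} (hB : IsSigmaCompact B) : MeasurableSet (hits B) := by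
  obtain ⟨K, hK, rfl⟩ := hB
  rw [hits_eq_image, Set.preimage_iUnion, Set.image_iUnion]
  simp_rw [← hits_eq_image]
  exact .iUnion fun n => (isCompact_hits (hK n)).measurableSet

lemma isSigmaCompact_inter_cell {B : Set E3} (hB : IsSigmaCompact B) (m i : ℕ) :
    IsSigmaCompact (B ∩ cell m i) :=
  isSigmaCompact_inter hB (isSigmaCompact_of_isLocallyClosed (isLocallyClosed_cell m i))

lemma cellCount_points_inter (B : Set E3) (m : ℕ) (l : Ray) :
    cellCount (l.points ∩ B) m = ∑' i, (hits (B ∩ cell m i)).indicator 1 l := by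
  classical
  simp [cellCount, hits, Set.indicator_apply, Set.inter_assoc, iSup_eq_if]

lemma measurable_cellCount_points_inter {B : Set E3} (hB : IsSigmaCompact B) (m : ℕ) :
    Measurable fun l : Ray => cellCount (l.points ∩ B) m := by
  simp_rw [cellCount_points_inter]
  exact .tsum fun i =>
    measurable_one.indicator (measurableSet_hits (isSigmaCompact_inter_cell hB m i))

lemma hitCount_eq_liminf {B : Set E3} (hB : MeasurableSet B) (l : Ray) :
    hitCount B l = liminf (fun m => cellCount (l.points ∩ B) m) atTop :=
  count_eq_liminf_cellCount (l.measurableSet_points.inter hB)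

lemma measurable_hitCount {B : Set E3} (hB : IsSigmaCompact B) : Measurable (hitCount B) := by
  simp_rw [funext (hitCount_eq_liminf (measurableSet_of_isSigmaCompact hB))]
  exact .liminf (measurable_cellCount_points_inter hB)

section PlaneMeasure

variable (d : sphere (0 : E3) 1)

lemma ofPlane_orthogonalProjectionOnto (x : E3) :
    ofPlane d ((ℝ ∙ (d : E3))ᗮ.orthogonalProjectionOnto x) = through (d, x) :=
  Subtype.ext (Prod.ext rfl (starProjection_orthogonal_unit (norm_eq_of_mem_sphere d) x))

lemma ofPlane_preimage_hits (B : Set E3) :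
    ofPlane d ⁻¹' hits B = (ℝ ∙ (d : E3))ᗮ.orthogonalProjectionOnto '' B := by
  ext p
  have hmem (x : E3) : x ∈ (ofPlane d p).points ↔
      (ℝ ∙ (d : E3))ᗮ.orthogonalProjectionOnto x = p := by
    rw [mem_points_iff]
    change through (d, x) = _ ↔ _
    rw [← ofPlane_orthogonalProjectionOnto]
    exact ⟨fun h => Subtype.ext (congrArg base h), congrArg _⟩
  simp only [Set.mem_preimage, hits, Set.mem_ofPred_eq, Set.Nonempty, Set.mem_inter_iff, hmem,
    Set.mem_image, and_comm]

lemma finrank_orthogonal : Module.finrank ℝ (ℝ ∙ (d : E3))ᗮ = 2 := by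
  have : Fact (Module.finrank ℝ E3 = 2 + 1) := ⟨by simp⟩
  exact Submodule.finrank_orthogonal_span_singleton (ne_zero_of_mem_unit_sphere d)

lemma planeMeasure_hits {B : Set E3} (hB : MeasurableSet (hits B)) :
    planeMeasure d (hits B) = surfaceMeasure ((ℝ ∙ (d : E3))ᗮ.starProjection '' B) := by
  rw [planeMeasure, Measure.map_apply (measurable_ofPlane d) hB, ofPlane_preimage_hits,
    ← InnerProductSpace.euclideanHausdorffMeasure_eq_volume, finrank_orthogonal,
    ← isometry_subtype_coe.euclideanHausdorffMeasure_image, Set.image_image]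
  rfl

lemma planeMeasure_hits_le {B : Set E3} (hB : MeasurableSet (hits B)) :
    planeMeasure d (hits B) ≤ surfaceMeasure B := by
  have hlip : LipschitzWith 1 (ℝ ∙ (d : E3))ᗮ.starProjection :=
    ContinuousLinearMap.lipschitzWith_of_opNorm_le (Submodule.starProjection_norm_le _)
  rw [planeMeasure_hits d hB]
  simpa [surfaceMeasure] using
    euclideanHausdorffMeasure_image_le_of_lipschitzOnWith (d := 2)
      (hlip.lipschitzOnWith (s := B))

lemma lintegral_hitCount_planeMeasure_le {B : Set E3} (hB : IsSigmaCompact B) :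
    ∫⁻ l, hitCount B l ∂planeMeasure d ≤ surfaceMeasure B := by
  have hBm := measurableSet_of_isSigmaCompact hB
  have hm (m i : ℕ) := measurableSet_hits (isSigmaCompact_inter_cell hB m i)
  have hcell (m : ℕ) :
      ∫⁻ l : Ray, cellCount (l.points ∩ B) m ∂planeMeasure d ≤ surfaceMeasure B := by
    simp_rw [cellCount_points_inter]
    rw [lintegral_tsum fun i => (measurable_one.indicator (hm m i)).aemeasurable,
      ← tsum_measure_inter_cell surfaceMeasure hBm m]
    refine ENNReal.tsum_le_tsum fun i => ?_
    rw [lintegral_indicator_one (hm m i)]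
    exact planeMeasure_hits_le d (hm m i)
  simp_rw [hitCount_eq_liminf hBm]
  exact (lintegral_liminf_le (measurable_cellCount_points_inter hB)).trans
    (liminf_le_of_frequently_le' (.of_forall hcell))

lemma planeMeasure_hits_le_ediam {F : Set E3} (hF : IsCompact F) :
    planeMeasure d (hits F) ≤ ENNReal.ofReal Real.pi * ediam F ^ 2 := by
  rw [planeMeasure, Measure.map_apply (measurable_ofPlane d) (isCompact_hits hF).measurableSet,
    ofPlane_preimage_hits]
  rcases F.eq_empty_or_nonempty with rfl | ⟨x, hx⟩
  · simp
  have hrank := finrank_orthogonal d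
  have : Nontrivial (ℝ ∙ (d : E3))ᗮ := Module.nontrivial_of_finrank_pos (R := ℝ) (hrank ▸ two_pos)
  set P := (ℝ ∙ (d : E3))ᗮ.orthogonalProjectionOnto
  have hsub : P '' F ⊆ closedBall (P x) (diam F) := by
    rintro _ ⟨y, hy, rfl⟩
    rw [mem_closedBall, dist_eq_norm, ← map_sub]
    refine (Submodule.norm_orthogonalProjectionOnto_apply_le _ _).trans ?_
    rw [← dist_eq_norm]
    exact dist_le_diam_of_mem hF.isBounded hy hx
  refine (measure_mono hsub).trans_eq ?_
  rw [InnerProductSpace.volume_closedBall_of_dim_even (k := 1) (by rw [hrank]), hrank, diam,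
    ENNReal.ofReal_toReal hF.isBounded.ediam_ne_top, mul_comm]
  simp

end PlaneMeasure

lemma lintegral_measure {f : Ray → ℝ≥0∞} (hf : Measurable f) :
    ∫⁻ l, f l ∂(Ray.measure) =
      ∫⁻ d, ∫⁻ l, f l ∂planeMeasure d ∂(volume : Measure E3).toSphere :=
  Measure.lintegral_bind measurable_planeMeasure.aemeasurable hf.aemeasurable

lemma lintegral_hitCount_le {B : Set E3} (hB : IsSigmaCompact B) :
    ∫⁻ l, hitCount B l ∂(Ray.measure) ≤
      surfaceMeasure B * (volume : Measure E3).toSphere Set.univ := by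
  rw [lintegral_measure (measurable_hitCount hB), ← lintegral_const]
  exact lintegral_mono fun d => lintegral_hitCount_planeMeasure_le d hB

lemma measure_hits_le_ediam {F : Set E3} (hF : IsCompact F) :
    Ray.measure (hits F) ≤
      ENNReal.ofReal Real.pi * (volume : Measure E3).toSphere Set.univ * ediam F ^ 2 := by
  rw [Ray.measure, Measure.bind_apply (isCompact_hits hF).measurableSet
    measurable_planeMeasure.aemeasurable, mul_right_comm, ← lintegral_const]
  exact lintegral_mono fun d => planeMeasure_hits_le_ediam d hF

/-- `B ↦ Ray.measure (hits B)` is an outer measure, and it is dominated by the one from which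
two-dimensional Hausdorff measure is built. -/
lemma measure_hits_eq_zero {Z : Set E3} (hZ : surfaceMeasure Z = 0) :
    Ray.measure (hits Z) = 0 := by
  set c := ENNReal.ofReal Real.pi * (volume : Measure E3).toSphere Set.univ
  have hc : c ≠ ∞ := ENNReal.mul_ne_top ENNReal.ofReal_ne_top (measure_ne_top _ _)
  have hc0 : c ≠ 0 := mul_ne_zero (by simpa using Real.pi_pos)
    (isOpen_univ.measure_pos _ ⟨pole, trivial⟩).ne'
  let ν : OuterMeasure E3 := (OuterMeasure.comap through Ray.measure.toOuterMeasure).map Prod.snd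
  have hν (B : Set E3) : ν B = Ray.measure (hits B) := by rw [hits_eq_image]; rfl
  have hle : ν ≤ OuterMeasure.mkMetric (c • fun r => r ^ (2 : ℝ)) := by
    refine OuterMeasure.le_mkMetric _ _ 1 one_pos fun s hs => ?_
    have hbdd : Bornology.IsBounded s :=
      isBounded_iff_ediam_ne_top.2 (ne_top_of_le_ne_top ENNReal.one_ne_top hs)
    rw [hν]
    refine (measure_mono (hits_mono subset_closure)).trans
      ((measure_hits_le_ediam hbdd.isCompact_closure).trans_eq ?_)
    simp [c, ediam_closure]
  rw [OuterMeasure.mkMetric_smul _ hc hc0] at hle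
  have hH : OuterMeasure.mkMetric (fun r => r ^ (2 : ℝ)) Z = 0 := by
    rw [OuterMeasure.coe_mkMetric]
    simpa [Measure.hausdorffMeasure] using euclideanHausdorffMeasure_eq_zero_iff.1 hZ
  refine le_antisymm ?_ zero_le
  calc Ray.measure (hits Z) = ν Z := (hν Z).symm
    _ ≤ c * OuterMeasure.mkMetric (fun r => r ^ (2 : ℝ)) Z := hle Z
    _ = 0 := by rw [hH, mul_zero]

section Flat

variable {n d : sphere (0 : E3) 1} {ε η : ℝ} {K : Set E3}

lemma lintegral_hitCount_planeMeasure_eq_of_isFlat (hK : IsCompact K) (hflat : IsFlat ε (n : E3) K)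
    (hε : ε < |⟪(n : E3), (d : E3)⟫|) :
    ∫⁻ l, hitCount K l ∂planeMeasure d =
      surfaceMeasure ((ℝ ∙ (d : E3))ᗮ.starProjection '' K) := by
  have hm := (isCompact_hits hK).measurableSet
  rw [← planeMeasure_hits d hm, ← lintegral_indicator_one hm, planeMeasure,
    lintegral_map (measurable_hitCount hK.isSigmaCompact) (measurable_ofPlane d),
    lintegral_map (measurable_one.indicator hm) (measurable_ofPlane d)]
  refine lintegral_congr fun p => ?_
  have hsub := hflat.subsingleton_inter_line (L := (ofPlane d p).points)
    (norm_eq_of_mem_sphere d) hε fun _ hx _ hy => exists_sub_eq_smul_dir hx hy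
  rw [hitCount]
  rcases hsub.eq_empty_or_singleton with h | ⟨x, h⟩
  · rw [h, measure_empty, Set.indicator_of_notMem fun hne => hne.ne_empty h]
  · rw [h, Measure.count_singleton, Set.indicator_of_mem (s := hits K)
      (h.symm ▸ Set.singleton_nonempty x : ((ofPlane d p).points ∩ K).Nonempty), Pi.one_apply]

lemma lintegral_hitCount_planeMeasure_bounds_of_isFlat (hη0 : 0 < η) (hη1 : η < 1)
    (hK : IsCompact K) (hflat : IsFlat (η ^ 2) (n : E3) K) (hd : d ∉ band n η) :
    ENNReal.ofReal ((1 - η) ^ 2) * ENNReal.ofReal |⟪(n : E3), (d : E3)⟫| * surfaceMeasure K ≤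
        ∫⁻ l, hitCount K l ∂planeMeasure d ∧
      ∫⁻ l, hitCount K l ∂planeMeasure d ≤
        ENNReal.ofReal ((1 + η) ^ 2) * ENNReal.ofReal |⟪(n : E3), (d : E3)⟫| *
          surfaceMeasure K := by
  have hnd : η ≤ |⟪(n : E3), (d : E3)⟫| := not_lt.1 hd
  have hne : ⟪(n : E3), (d : E3)⟫ ≠ 0 := abs_pos.1 (hη0.trans_le hnd)
  have hflat' := hflat.mono subset_rfl (sq η ▸ mul_le_mul_of_nonneg_left hnd hη0.le)
  have hrank : Module.finrank ℝ E3 = 2 + 1 := by simp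
  have hn := norm_eq_of_mem_sphere n
  have hd := norm_eq_of_mem_sphere d
  rw [lintegral_hitCount_planeMeasure_eq_of_isFlat hK hflat (by nlinarith),
    ← ENNReal.ofReal_mul (by positivity), ← ENNReal.ofReal_mul (by positivity)]
  exact ⟨hflat'.le_euclideanHausdorffMeasure_starProjection_image hη1 hrank hn hd hne,
    hflat'.euclideanHausdorffMeasure_starProjection_image_le hη0.le hrank hn hd hne⟩

lemma measurable_abs_inner (n : sphere (0 : E3) 1) :
    Measurable fun d : sphere (0 : E3) 1 => ENNReal.ofReal |⟪(n : E3), (d : E3)⟫| :=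
  (ENNReal.continuous_ofReal.comp (by fun_prop)).measurable

lemma measurable_indicator_band (n : sphere (0 : E3) 1) (η : ℝ) :
    Measurable ((band n η).indicator (1 : sphere (0 : E3) 1 → ℝ≥0∞)) :=
  measurable_one.indicator (measurableSet_band n η)

lemma lintegral_const_mul_abs_inner_mul (a b : ℝ≥0∞) (n : sphere (0 : E3) 1) :
    ∫⁻ d : sphere (0 : E3) 1, a * ENNReal.ofReal |⟪(n : E3), (d : E3)⟫| * b
      ∂(volume : Measure E3).toSphere = a * croftonConst * b := by
  rw [lintegral_mul_const _ ((measurable_abs_inner n).const_mul a),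
    lintegral_const_mul _ (measurable_abs_inner n), lintegral_abs_inner_toSphere]

lemma lintegral_indicator_band_mul (b : ℝ≥0∞) (n : sphere (0 : E3) 1) (η : ℝ) :
    ∫⁻ d, (band n η).indicator 1 d * b ∂(volume : Measure E3).toSphere =
      (volume : Measure E3).toSphere (band pole η) * b := by
  rw [lintegral_mul_const _ (measurable_indicator_band n η),
    lintegral_indicator_one (measurableSet_band n η), toSphere_band_eq n pole]

lemma lintegral_hitCount_le_of_isFlat (hη0 : 0 < η) (hη1 : η < 1) (hK : IsCompact K)
    (hflat : IsFlat (η ^ 2) (n : E3) K) :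
    ∫⁻ l, hitCount K l ∂(Ray.measure) ≤
      (ENNReal.ofReal ((1 + η) ^ 2) * croftonConst +
        (volume : Measure E3).toSphere (band pole η)) * surfaceMeasure K := by
  rw [lintegral_measure (measurable_hitCount hK.isSigmaCompact), add_mul,
    ← lintegral_const_mul_abs_inner_mul _ _ n, ← lintegral_indicator_band_mul _ n,
    ← lintegral_add_right _ ((measurable_indicator_band n η).mul_const _)]
  refine lintegral_mono fun d => ?_
  by_cases hd : d ∈ band n η
  · rw [Set.indicator_of_mem hd, Pi.one_apply, one_mul]
    exact (lintegral_hitCount_planeMeasure_le d hK.isSigmaCompact).trans le_add_self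
  · rw [Set.indicator_of_notMem hd, zero_mul, add_zero]
    exact (lintegral_hitCount_planeMeasure_bounds_of_isFlat hη0 hη1 hK hflat hd).2

lemma le_lintegral_hitCount_of_isFlat (hη0 : 0 < η) (hη1 : η < 1) (hK : IsCompact K)
    (hflat : IsFlat (η ^ 2) (n : E3) K) :
    ENNReal.ofReal ((1 - η) ^ 2) * croftonConst * surfaceMeasure K ≤
      ∫⁻ l, hitCount K l ∂(Ray.measure) +
        (volume : Measure E3).toSphere (band pole η) * surfaceMeasure K := by
  rw [lintegral_measure (measurable_hitCount hK.isSigmaCompact),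
    ← lintegral_const_mul_abs_inner_mul _ _ n, ← lintegral_indicator_band_mul _ n,
    ← lintegral_add_right _ ((measurable_indicator_band n η).mul_const _)]
  refine lintegral_mono fun d => ?_
  by_cases hd : d ∈ band n η
  · rw [Set.indicator_of_mem hd, Pi.one_apply]
    have hinner : |⟪(n : E3), (d : E3)⟫| ≤ 1 := by
      simpa using abs_real_inner_le_norm (n : E3) (d : E3)
    refine le_add_self.trans' (mul_le_mul_left (mul_le_one' ?_ ?_) _)
    · exact ENNReal.ofReal_le_one.2 (by nlinarith)
    · exact ENNReal.ofReal_le_one.2 hinner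
  · rw [Set.indicator_of_notMem hd, zero_mul, add_zero]
    exact (lintegral_hitCount_planeMeasure_bounds_of_isFlat hη0 hη1 hK hflat hd).1

end Flat

end Ray

section InnerRegular

variable {X : Type*} [MeasurableSpace X] {μ ν : Measure X}

lemma le_of_forall_restrict_le {𝒟 : Set (Set X)} (h𝒟 : 𝒟.Countable)
    (hmeas : ∀ D ∈ 𝒟, MeasurableSet D) (hnull : μ (⋃₀ 𝒟)ᶜ = 0)
    (h : ∀ D ∈ 𝒟, μ.restrict D ≤ ν) : μ ≤ ν := by
  rcases 𝒟.eq_empty_or_nonempty with rfl | hne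
  · rw [Set.sUnion_empty, Set.compl_empty, Measure.measure_univ_eq_zero] at hnull
    exact hnull ▸ Measure.zero_le ν
  obtain ⟨D, rfl⟩ := h𝒟.exists_eq_range hne
  rw [Set.forall_mem_range] at hmeas h
  have hmeas' (k : ℕ) : MeasurableSet (disjointed D k) := .disjointed hmeas k
  have hpiece (k : ℕ) : μ.restrict (disjointed D k) ≤ ν.restrict (disjointed D k) := by
    rw [← Measure.restrict_restrict_of_subset (disjointed_subset D k)]
    exact Measure.restrict_mono subset_rfl (h k)
  calc μ = μ.restrict (⋃ k, disjointed D k) := by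
        rw [iUnion_disjointed, ← Set.sUnion_range]
        exact (Measure.restrict_eq_self_of_ae_mem hnull).symm
    _ = Measure.sum fun k => μ.restrict (disjointed D k) :=
        Measure.restrict_iUnion (disjoint_disjointed D) hmeas'
    _ ≤ Measure.sum fun k => ν.restrict (disjointed D k) := Measure.le_intro fun A hA _ => by
        simp_rw [Measure.sum_apply _ hA]
        exact ENNReal.tsum_le_tsum fun k => hpiece k A
    _ = ν.restrict (⋃ k, disjointed D k) :=
        (Measure.restrict_iUnion (disjoint_disjointed D) hmeas').symm
    _ ≤ ν := Measure.restrict_le_self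

variable [TopologicalSpace X]

/-- A `σ`-compact set `B ⊆ S` that fills the set `S` up to a `μ`-null set. Intersection counts are
measurable functions of the ray for `σ`-compact sets, so surfaces are replaced by such cores. -/
structure IsSigmaCompactCore (μ : Measure X) (S B : Set X) : Prop where
  subset : B ⊆ S
  isSigmaCompact : IsSigmaCompact B
  measure_sdiff_eq_zero : μ (S \ B) = 0

variable [μ.InnerRegularCompactLTTop]

lemma restrict_le_of_forall_isCompact_le {D : Set X} (hD : MeasurableSet D) (hfin : μ D ≠ ∞)
    (h : ∀ K ⊆ D, IsCompact K → μ K ≤ ν K) : μ.restrict D ≤ ν := by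
  refine Measure.le_iff.2 fun A hA => ?_
  rw [Measure.restrict_apply hA, (hA.inter hD).measure_eq_iSup_isCompact_of_ne_top
    (measure_ne_top_of_subset Set.inter_subset_right hfin)]
  exact iSup₂_le fun K hK => iSup_le fun hKc =>
    (h K (hK.trans Set.inter_subset_right) hKc).trans
      (measure_mono (hK.trans Set.inter_subset_left))

lemma exists_isSigmaCompactCore [OpensMeasurableSpace X] [T2Space X] {S : Set X}
    (hS : MeasurableSet S) (hfin : μ S ≠ ∞) : ∃ B, IsSigmaCompactCore μ S B := by
  have hex (m : ℕ) : ∃ K ⊆ S, IsCompact K ∧ μ (S \ K) < (m + 1 : ℝ≥0∞)⁻¹ :=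
    hS.exists_isCompact_sdiff_lt hfin (by simp)
  choose K hKS hK hlt using hex
  refine ⟨⋃ m, K m, Set.iUnion_subset hKS, isSigmaCompact_iUnion_of_isCompact _ hK, ?_⟩
  have hle (m : ℕ) : μ (S \ ⋃ m, K m) ≤ (m + 1 : ℝ≥0∞)⁻¹ :=
    (measure_mono (Set.sdiff_subset_sdiff_right (Set.subset_iUnion K m))).trans (hlt m).le
  have hlim : Tendsto (fun m : ℕ => (m + 1 : ℝ≥0∞)⁻¹) atTop (𝓝 0) := by
    simpa using (tendsto_add_atTop_iff_nat 1).2 ENNReal.tendsto_inv_nat_nhds_zero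
  exact le_antisymm (ge_of_tendsto' hlim hle) zero_le

end InnerRegular

lemma IsSurface.exists_isSigmaCompactCore {S : Set E3} (hS : IsSurface S) :
    ∃ B, IsSigmaCompactCore surfaceMeasure S B := by
  have : IsFiniteMeasure (surfaceMeasure.restrict S) := ⟨by simpa using hS.area_lt_top⟩
  obtain ⟨B, hBS, hB, hnull⟩ :=
    _root_.exists_isSigmaCompactCore hS.measurableSet (measure_ne_top (surfaceMeasure.restrict S) S)
  refine ⟨B, hBS, hB, ?_⟩
  rwa [Measure.restrict_apply (hS.measurableSet.diff (measurableSet_of_isSigmaCompact hB)),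
    Set.inter_eq_left.2 Set.sdiff_subset] at hnull

namespace Ray

open Classical in
/-- The counting measure on the points of `B` on a ray. It is set to zero on the null set of rays
with infinitely many such points, so that it is always a finite measure. -/
def crossing (B : Set E3) (l : Ray) : Measure E3 :=
  if hitCount B l = ∞ then 0 else Measure.count.restrict (l.points ∩ B)

section Crossing

variable {B C : Set E3} {l : Ray}

lemma crossing_apply (h : hitCount B l ≠ ∞) (hC : MeasurableSet C) :
    crossing B l C = hitCount (B ∩ C) l := by
  rw [crossing, if_neg h, Measure.restrict_apply hC, hitCount, Set.inter_comm, Set.inter_assoc]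

instance (B : Set E3) (l : Ray) : IsFiniteMeasure (crossing B l) := by
  constructor
  by_cases h : hitCount B l = ∞
  · simp [crossing, h]
  · rw [crossing_apply h .univ, Set.inter_univ]
    exact lt_top_iff_ne_top.2 h

variable (hB : IsSigmaCompact B)
include hB

lemma measurable_crossing_apply_of_isClosed (hC : IsClosed C) :
    Measurable fun l => crossing B l C := by
  classical
  have hpiece : (fun l => crossing B l C) =
      {l | hitCount B l = ∞}.piecewise 0 (hitCount (B ∩ C)) := by
    ext l
    by_cases h : hitCount B l = ∞
    · rw [Set.piecewise_eq_of_mem _ _ _ (show l ∈ {l | hitCount B l = ∞} from h)]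
      simp [crossing, h]
    · rw [Set.piecewise_eq_of_notMem _ _ _ (show l ∉ {l | hitCount B l = ∞} from h),
        crossing_apply h hC.measurableSet]
  rw [hpiece]
  exact .piecewise (measurable_hitCount hB (measurableSet_singleton _)) measurable_zero
    (measurable_hitCount
      (isSigmaCompact_inter hB (isSigmaCompact_of_isLocallyClosed hC.isLocallyClosed)))

lemma measurable_crossing : Measurable (crossing B) :=
  .measure_of_isPiSystem (S := {C | IsClosed C})
    (BorelSpace.measurable_eq.trans borel_eq_generateFrom_isClosed) isPiSystem_isClosed
    (fun _ hC => measurable_crossing_apply_of_isClosed hB hC)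
    (measurable_crossing_apply_of_isClosed hB isClosed_univ)

variable (hfin : surfaceMeasure B ≠ ∞)
include hfin

lemma ae_hitCount_ne_top : ∀ᵐ l ∂(Ray.measure), hitCount B l ≠ ∞ := by
  have hint : ∫⁻ l, hitCount B l ∂(Ray.measure) ≠ ∞ :=
    ne_top_of_le_ne_top (ENNReal.mul_ne_top hfin (measure_ne_top _ _)) (lintegral_hitCount_le hB)
  filter_upwards [ae_lt_top (measurable_hitCount hB) hint] with l hl using hl.ne

lemma bind_crossing_apply (hC : MeasurableSet C) :
    Ray.measure.bind (crossing B) C = ∫⁻ l, hitCount (B ∩ C) l ∂(Ray.measure) := by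
  rw [Measure.bind_apply hC (measurable_crossing hB).aemeasurable]
  refine lintegral_congr_ae ?_
  filter_upwards [ae_hitCount_ne_top hB hfin] with l hl using crossing_apply hl hC

lemma isFiniteMeasure_bind_crossing : IsFiniteMeasure (Ray.measure.bind (crossing B)) := by
  constructor
  rw [bind_crossing_apply hB hfin .univ, Set.inter_univ]
  exact (lintegral_hitCount_le hB).trans_lt (ENNReal.mul_lt_top hfin.lt_top (measure_lt_top _ _))

lemma bind_crossing_apply_eq_zero (hC : MeasurableSet C) (h : surfaceMeasure (B ∩ C) = 0) :
    Ray.measure.bind (crossing B) C = 0 := by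
  rw [bind_crossing_apply hB hfin hC]
  refine lintegral_eq_zero_of_ae_eq_zero ?_
  filter_upwards [measure_eq_zero_iff_ae_notMem.1 (measure_hits_eq_zero h)] with l hl
  rw [hitCount, Set.not_nonempty_iff_eq_empty.1 hl, measure_empty, Pi.zero_apply]

end Crossing

section Crofton

lemma tendsto_ofReal_sq_mul_croftonConst (s : ℝ) :
    Tendsto (fun η : ℝ => ENNReal.ofReal ((1 + s * η) ^ 2) * croftonConst) (𝓝[>] 0)
      (𝓝 croftonConst) := by
  have hcont : Continuous fun η : ℝ => ENNReal.ofReal ((1 + s * η) ^ 2) :=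
    ENNReal.continuous_ofReal.comp (by fun_prop)
  have hlim : Tendsto (fun η : ℝ => ENNReal.ofReal ((1 + s * η) ^ 2)) (𝓝[>] 0) (𝓝 1) := by
    simpa using hcont.continuousWithinAt.tendsto (x := 0)
  simpa using ENNReal.Tendsto.mul_const hlim (Or.inl one_ne_zero) (b := croftonConst)

variable {S B : Set E3} (hS : IsSurface S) (hB : IsSigmaCompactCore surfaceMeasure S B)
include hS hB

lemma surfaceMeasure_core_ne_top : surfaceMeasure B ≠ ∞ :=
  ne_top_of_le_ne_top hS.area_lt_top.ne (measure_mono hB.subset)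

lemma exists_countable_isFlat_core_cover {ε : ℝ} (hε : 0 < ε) :
    ∃ 𝒟 : Set (Set E3), 𝒟.Countable ∧
      (∀ D ∈ 𝒟, MeasurableSet D ∧ D ⊆ B ∧ ∃ n : sphere (0 : E3) 1, IsFlat ε (n : E3) D) ∧
      surfaceMeasure.restrict S (⋃₀ 𝒟)ᶜ = 0 ∧ Ray.measure.bind (crossing B) (⋃₀ 𝒟)ᶜ = 0 := by
  obtain ⟨𝒦, h𝒦, hflat, hnull⟩ := hS.exists_countable_isCompact_isFlat_cover hε
  have hBm := measurableSet_of_isSigmaCompact hB.isSigmaCompact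
  have hmeas : ∀ D ∈ (B ∩ ·) '' 𝒦, MeasurableSet D := by
    rintro _ ⟨K, hK, rfl⟩
    exact hBm.inter (hflat K hK).1.measurableSet
  have hrest : surfaceMeasure (S \ ⋃₀ ((B ∩ ·) '' 𝒦)) = 0 := by
    refine measure_mono_null (fun x hx => ?_)
      (measure_union_null hB.measure_sdiff_eq_zero hnull)
    by_cases hxB : x ∈ B
    · exact Or.inr ⟨hx.1, fun ⟨K, hK, hxK⟩ => hx.2 ⟨B ∩ K, ⟨K, hK, rfl⟩, hxB, hxK⟩⟩
    · exact Or.inl ⟨hx.1, hxB⟩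
  have hcompl := (MeasurableSet.sUnion (h𝒦.image _) hmeas).compl
  refine ⟨(B ∩ ·) '' 𝒦, h𝒦.image _, fun D hD => ⟨hmeas D hD, ?_⟩, ?_, ?_⟩
  · obtain ⟨K, hK, rfl⟩ := hD
    obtain ⟨-, n, hn, hKn⟩ := hflat K hK
    exact ⟨Set.inter_subset_left, ⟨n, by simpa using hn⟩, hKn.mono Set.inter_subset_right le_rfl⟩
  · rwa [Measure.restrict_apply hcompl, Set.inter_comm, ← Set.sdiff_eq]
  · exact bind_crossing_apply_eq_zero hB.isSigmaCompact (surfaceMeasure_core_ne_top hS hB) hcompl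
      (measure_mono_null (Set.inter_subset_inter_left _ hB.subset) hrest)

lemma bind_crossing_apply_of_subset {C : Set E3} (hC : MeasurableSet C) (hCB : C ⊆ B) :
    Ray.measure.bind (crossing B) C = ∫⁻ l, hitCount C l ∂(Ray.measure) := by
  rw [bind_crossing_apply hB.isSigmaCompact (surfaceMeasure_core_ne_top hS hB) hC,
    Set.inter_eq_right.2 hCB]

section Squeeze

variable {η : ℝ} (hη0 : 0 < η) (hη1 : η < 1)
include hη0 hη1

lemma bind_crossing_le :
    Ray.measure.bind (crossing B) ≤ (ENNReal.ofReal ((1 + η) ^ 2) * croftonConst +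
      (volume : Measure E3).toSphere (band pole η)) • surfaceMeasure.restrict S := by
  have := isFiniteMeasure_bind_crossing hB.isSigmaCompact (surfaceMeasure_core_ne_top hS hB)
  obtain ⟨𝒟, h𝒟, hD, -, hnull⟩ := exists_countable_isFlat_core_cover hS hB (pow_pos hη0 2)
  refine le_of_forall_restrict_le h𝒟 (fun D h => (hD D h).1) hnull fun D h => ?_
  obtain ⟨hDm, hDB, n, hflat⟩ := hD D h
  refine restrict_le_of_forall_isCompact_le hDm (measure_ne_top _ _) fun K hKD hK => ?_
  rw [bind_crossing_apply_of_subset hS hB hK.measurableSet (hKD.trans hDB), Measure.smul_apply,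
    Measure.restrict_eq_self _ (hKD.trans (hDB.trans hB.subset))]
  exact lintegral_hitCount_le_of_isFlat hη0 hη1 hK (hflat.mono hKD le_rfl)

lemma le_bind_crossing_add :
    (ENNReal.ofReal ((1 - η) ^ 2) * croftonConst) • surfaceMeasure.restrict S ≤
      Ray.measure.bind (crossing B) +
        (volume : Measure E3).toSphere (band pole η) • surfaceMeasure.restrict S := by
  have : IsFiniteMeasure (surfaceMeasure.restrict S) := ⟨by simpa using hS.area_lt_top⟩
  have : IsFiniteMeasure
      ((ENNReal.ofReal ((1 - η) ^ 2) * croftonConst) • surfaceMeasure.restrict S) :=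
    Measure.smul_finite _ (ENNReal.mul_ne_top (by simp) croftonConst_ne_top)
  obtain ⟨𝒟, h𝒟, hD, hnull, -⟩ := exists_countable_isFlat_core_cover hS hB (pow_pos hη0 2)
  refine le_of_forall_restrict_le h𝒟 (fun D h => (hD D h).1)
    (by rw [Measure.smul_apply, hnull, smul_zero]) fun D h => ?_
  obtain ⟨hDm, hDB, n, hflat⟩ := hD D h
  refine restrict_le_of_forall_isCompact_le hDm (measure_ne_top _ _) fun K hKD hK => ?_
  rw [Measure.add_apply, bind_crossing_apply_of_subset hS hB hK.measurableSet (hKD.trans hDB),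
    Measure.smul_apply, Measure.smul_apply,
    Measure.restrict_eq_self _ (hKD.trans (hDB.trans hB.subset))]
  exact le_lintegral_hitCount_of_isFlat hη0 hη1 hK (hflat.mono hKD le_rfl)

end Squeeze

theorem bind_crossing_eq_croftonConst_smul :
    Ray.measure.bind (crossing B) = croftonConst • surfaceMeasure.restrict S := by
  have : IsFiniteMeasure (surfaceMeasure.restrict S) := ⟨by simpa using hS.area_lt_top⟩
  have hsmall : ∀ᶠ η : ℝ in 𝓝[>] 0, 0 < η ∧ η < 1 := Ioo_mem_nhdsGT one_pos
  refine le_antisymm (Measure.le_iff.2 fun A _ => ?_) (Measure.le_iff.2 fun A _ => ?_)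
  · have hlim := ENNReal.Tendsto.mul_const
      ((tendsto_ofReal_sq_mul_croftonConst 1).add (tendsto_toSphere_band pole))
      (b := surfaceMeasure.restrict S A) (Or.inr (measure_ne_top _ _))
    rw [add_zero] at hlim
    refine ge_of_tendsto hlim ?_
    filter_upwards [hsmall] with η hη
    simpa using bind_crossing_le hS hB hη.1 hη.2 A
  · have hlim := ENNReal.Tendsto.mul_const (tendsto_ofReal_sq_mul_croftonConst (-1))
      (b := surfaceMeasure.restrict S A) (Or.inr (measure_ne_top _ _))
    have hlim' := (ENNReal.Tendsto.mul_const (tendsto_toSphere_band pole)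
      (b := surfaceMeasure.restrict S A) (Or.inr (measure_ne_top _ _))).const_add
        (Ray.measure.bind (crossing B) A)
    rw [zero_mul, add_zero] at hlim'
    refine le_of_tendsto_of_tendsto hlim hlim' ?_
    filter_upwards [hsmall] with η hη
    simpa [sub_eq_add_neg] using le_bind_crossing_add hS hB hη.1 hη.2 A

end Crofton

end Ray

section SampleMean

/-- The mean of `f` over the first `N` points of a sequence. -/
def sampleMean {E : Type*} (f : E → ℝ) (N : ℕ) (x : ℕ → E) : ℝ :=
  (∑ j ∈ Finset.range N, f (x j)) / N

variable {E : Type*} [MeasurableSpace E] {f : E → ℝ}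

lemma measurable_sampleMean (hf : Measurable f) (N : ℕ) : Measurable (sampleMean f N) := by
  unfold sampleMean; fun_prop

variable {Q : Measure E} [IsProbabilityMeasure Q]

lemma integrable_eval_infinitePi (hfi : Integrable f Q) (j : ℕ) :
    Integrable (fun x : ℕ → E => f (x j)) (Measure.infinitePi fun _ => Q) :=
  (measurePreserving_eval_infinitePi (fun _ : ℕ => Q) j).integrable_comp_of_integrable hfi

lemma integral_eval_infinitePi (hf : AEStronglyMeasurable f Q) (j : ℕ) :
    ∫ x, f (x j) ∂Measure.infinitePi (fun _ : ℕ => Q) = ∫ y, f y ∂Q :=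
  (measurePreserving_eval_infinitePi (fun _ : ℕ => Q) j).hasLaw.integral_comp hf

lemma iIndepFun_eval_infinitePi (hf : Measurable f) :
    iIndepFun (fun (j : ℕ) (x : ℕ → E) => f (x j)) (Measure.infinitePi fun _ : ℕ => Q) :=
  iIndepFun_infinitePi fun _ => hf

lemma ae_tendsto_sampleMean (hf : Measurable f) (hfi : Integrable f Q) :
    ∀ᵐ x ∂Measure.infinitePi (fun _ : ℕ => Q),
      Tendsto (fun N => sampleMean f N x) atTop (𝓝 (∫ y, f y ∂Q)) := by
  have heval (j : ℕ) := (measurePreserving_eval_infinitePi (fun _ : ℕ => Q) j).hasLaw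
  rw [← integral_eval_infinitePi hfi.1 0]
  exact strong_law_ae_real (fun (j : ℕ) (x : ℕ → E) => f (x j)) (integrable_eval_infinitePi hfi 0)
    (fun i j hij => (iIndepFun_eval_infinitePi hf).indepFun hij)
    fun j => ((heval j).identDistrib (heval 0)).comp hf

lemma integral_sampleMean (hfi : Integrable f Q) {N : ℕ} (hN : N ≠ 0) :
    ∫ x, sampleMean f N x ∂Measure.infinitePi (fun _ : ℕ => Q) = ∫ y, f y ∂Q := by
  simp_rw [sampleMean]
  rw [integral_div, integral_finsetSum _ fun j _ => integrable_eval_infinitePi hfi j]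
  have hN' : (N : ℝ) ≠ 0 := Nat.cast_ne_zero.2 hN
  simp [integral_eval_infinitePi hfi.1, mul_div_cancel_left₀ _ hN']

lemma integral_abs_sampleMean_le (hfi : Integrable f Q) (N : ℕ) :
    ∫ x, |sampleMean f N x| ∂Measure.infinitePi (fun _ : ℕ => Q) ≤ ∫ y, |f y| ∂Q := by
  rcases eq_or_ne N 0 with rfl | hN
  · simpa [sampleMean] using integral_nonneg fun y => abs_nonneg (f y)
  rw [← integral_sampleMean hfi.abs hN]
  refine integral_mono
    ((integrable_finsetSum _ fun j _ => integrable_eval_infinitePi hfi j).div_const _).abs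
    ((integrable_finsetSum _ fun j _ => integrable_eval_infinitePi hfi.abs j).div_const _)
    fun x => ?_
  simp only [sampleMean, abs_div, Nat.abs_cast]
  gcongr
  exact Finset.abs_sum_le_sum_abs _ _

lemma memLp_sampleMean {p : ℝ≥0∞} (hfp : MemLp f p Q) (N : ℕ) :
    MemLp (sampleMean f N) p (Measure.infinitePi fun _ : ℕ => Q) := by
  simp_rw [funext fun x => show sampleMean f N x = (N : ℝ)⁻¹ * ∑ j ∈ Finset.range N, f (x j) from
    div_eq_inv_mul _ _]
  exact (memLp_finsetSum _ fun j _ => hfp.comp_measurePreserving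
    (measurePreserving_eval_infinitePi (fun _ : ℕ => Q) j)).const_mul _

lemma variance_sampleMean (hf : Measurable f) (hf2 : MemLp f 2 Q) (N : ℕ) :
    Var[sampleMean f N; Measure.infinitePi fun _ : ℕ => Q] = Var[f; Q] / N := by
  have heval (j : ℕ) := measurePreserving_eval_infinitePi (fun _ : ℕ => Q) j
  have hsum := IndepFun.variance_sum (μ := Measure.infinitePi fun _ : ℕ => Q)
    (X := fun (j : ℕ) (x : ℕ → E) => f (x j)) (s := Finset.range N)
    (fun j _ => hf2.comp_measurePreserving (heval j))
    fun i _ j _ hij => (iIndepFun_eval_infinitePi hf).indepFun hij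
  have hvar (j : ℕ) : Var[fun x : ℕ → E => f (x j); Measure.infinitePi fun _ => Q] = Var[f; Q] :=
    (heval j).variance_fun_comp hf.aemeasurable
  simp only [hvar, Finset.sum_const, Finset.card_range, nsmul_eq_mul] at hsum
  have hmean : sampleMean f N =
      fun x => (N : ℝ)⁻¹ * (∑ j ∈ Finset.range N, fun x : ℕ → E => f (x j)) x := by
    ext x
    rw [Finset.sum_apply, sampleMean, div_eq_inv_mul]
  rw [hmean, variance_const_mul, hsum]
  rcases eq_or_ne N 0 with rfl | hN
  · simp
  · field_simp

lemma measureReal_le_abs_sampleMean_sub_integral (hf : Measurable f) {T : ℝ}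
    (hT : ∀ y, |f y| ≤ T) {c : ℝ} (hc : 0 < c) {N : ℕ} (hN : N ≠ 0) :
    (Measure.infinitePi fun _ : ℕ => Q).real {x | c ≤ |sampleMean f N x - ∫ y, f y ∂Q|} ≤
      T ^ 2 / N / c ^ 2 := by
  have hf2 : MemLp f 2 Q := .of_bound hf.aestronglyMeasurable T (ae_of_all _ hT)
  have hvar : Var[f; Q] ≤ T ^ 2 := by
    have := variance_le_sq_of_bounded (ae_of_all Q fun y => abs_le.1 (hT y)) hf.aemeasurable
    rwa [sub_neg_eq_add, add_self_div_two] at this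
  have hcheb := meas_ge_le_variance_div_sq (memLp_sampleMean hf2 N) hc
  rw [integral_sampleMean (hf2.integrable one_le_two) hN, variance_sampleMean hf hf2] at hcheb
  calc _ ≤ Var[f; Q] / N / c ^ 2 := ENNReal.toReal_le_of_le_ofReal
        (div_nonneg (div_nonneg (variance_nonneg _ _) N.cast_nonneg) (sq_nonneg c)) hcheb
    _ ≤ T ^ 2 / N / c ^ 2 := by gcongr

lemma measureReal_le_abs_sampleMean (hfi : Integrable f Q) {c : ℝ} (hc : 0 < c) (N : ℕ) :
    (Measure.infinitePi fun _ : ℕ => Q).real {x | c ≤ |sampleMean f N x|} ≤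
      (∫ y, |f y| ∂Q) / c := by
  have hint : Integrable (sampleMean f N) (Measure.infinitePi fun _ : ℕ => Q) :=
    memLp_one_iff_integrable.1 (memLp_sampleMean (memLp_one_iff_integrable.2 hfi) N)
  rw [le_div_iff₀ hc, mul_comm]
  exact (mul_meas_ge_le_integral_of_nonneg (ae_of_all _ fun _ => abs_nonneg _) hint.abs c).trans
    (integral_abs_sampleMean_le hfi N)

end SampleMean

section WeakLaw

lemma abs_sub_truncation_le {E : Type*} (f : E → ℝ) (T : ℝ) (y : E) :
    |f y - truncation f T y| ≤ |f y| := by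
  by_cases h : f y ∈ Set.Ioc (-T) T <;> simp [truncation, h]

variable {E : Type*} [MeasurableSpace E] {f : E → ℝ}

lemma measurable_truncation (hf : Measurable f) (T : ℝ) : Measurable (truncation f T) :=
  (measurable_id.indicator measurableSet_Ioc).comp hf

lemma tendsto_integral_abs_sub_truncation {Q : Measure E} (hfi : Integrable f Q) :
    Tendsto (fun T : ℝ => ∫ y, |f y - truncation f T y| ∂Q) atTop (𝓝 0) := by
  rw [← integral_zero E ℝ (μ := Q)]
  refine tendsto_integral_filter_of_dominated_convergence (fun y => |f y|)
    (.of_forall fun T => (hfi.1.sub hfi.1.truncation).norm)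
    (.of_forall fun T => ae_of_all _ fun y => ?_) hfi.abs (ae_of_all _ fun y => ?_)
  · simpa using abs_sub_truncation_le f T y
  · refine tendsto_const_nhds.congr' ?_
    filter_upwards [eventually_gt_atTop |f y|] with T hT
    rw [truncation_eq_self hT, sub_self, abs_zero]

lemma measureReal_le_abs_sampleMean_sub_integral_le_truncation {Q : Measure E}
    [IsProbabilityMeasure Q] (hf : Measurable f) (hfi : Integrable f Q) (T : ℝ) {c : ℝ}
    (hc : 0 < c) {N : ℕ} (hN : N ≠ 0) (htail : ∫ y, |f y - truncation f T y| ∂Q ≤ c) :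
    (Measure.infinitePi fun _ : ℕ => Q).real {x | 3 * c ≤ |sampleMean f N x - ∫ y, f y ∂Q|} ≤
      T ^ 2 / N / c ^ 2 + (∫ y, |f y - truncation f T y| ∂Q) / c := by
  set g := truncation f T
  have hg : Measurable g := measurable_truncation hf T
  have hgi : Integrable g Q := hfi.1.integrable_truncation
  have hsplit : {x | 3 * c ≤ |sampleMean f N x - ∫ y, f y ∂Q|} ⊆
      {x | c ≤ |sampleMean g N x - ∫ y, g y ∂Q|} ∪
        {x | c ≤ |sampleMean (fun y => f y - g y) N x|} := by
    intro x hx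
    have hmean : sampleMean (fun y => f y - g y) N x = sampleMean f N x - sampleMean g N x := by
      simp only [sampleMean, Finset.sum_sub_distrib, sub_div]
    have hbias : |∫ y, f y ∂Q - ∫ y, g y ∂Q| ≤ c := by
      rw [← integral_sub hfi hgi]
      exact abs_integral_le_integral_abs.trans htail
    by_contra! hcon
    simp only [Set.mem_union, Set.mem_ofPred_eq, not_or, not_le, hmean, abs_lt] at hcon hx
    rw [abs_le] at hbias
    exact hx.not_gt (abs_lt.2 ⟨by linarith, by linarith⟩)
  calc _ ≤ _ := measureReal_mono hsplit
    _ ≤ _ := measureReal_union_le _ _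
    _ ≤ _ := by
      rw [← sq_abs T]
      exact add_le_add
        (measureReal_le_abs_sampleMean_sub_integral hg (abs_truncation_le_bound f T) hc hN)
        (measureReal_le_abs_sampleMean (hfi.sub hgi) hc N)

/-- Convergence of the truncation errors plays the part of uniform integrability of `f` under the
varying laws. -/
lemma tendsto_measure_le_abs_sampleMean_sub {ι : Type*} {l : Filter ι} {Q : ι → Measure E}
    {Q₀ : Measure E} (hQ : ∀ᶠ i in l, IsProbabilityMeasure (Q i)) (hf : Measurable f)
    (hfQ : ∀ᶠ i in l, Integrable f (Q i)) (hfQ₀ : Integrable f Q₀)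
    (hint : Tendsto (fun i => ∫ y, f y ∂Q i) l (𝓝 (∫ y, f y ∂Q₀)))
    (htail : ∀ T : ℕ, Tendsto (fun i => ∫ y, |f y - truncation f T y| ∂Q i) l
      (𝓝 (∫ y, |f y - truncation f T y| ∂Q₀)))
    {ε : ℝ} (hε : 0 < ε) :
    Tendsto (fun p : ι × ℕ => Measure.infinitePi (fun _ : ℕ => Q p.1)
      {x | ε ≤ |sampleMean f p.2 x - ∫ y, f y ∂Q₀|}) (l ×ˢ atTop) (𝓝 0) := by
  refine ENNReal.tendsto_nhds_zero.2 fun a ha => ?_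
  obtain ⟨δ, hδ0, hδa⟩ : ∃ δ : ℝ, 0 < δ ∧ ENNReal.ofReal δ ≤ a := by
    obtain ⟨δ, hδ0, hδa⟩ := ENNReal.lt_iff_exists_nnreal_btwn.1 ha
    exact ⟨δ, by exact_mod_cast hδ0, by simpa using hδa.le⟩
  set c := ε / 4 with hc
  have hc0 : 0 < c := by positivity
  obtain ⟨T, hT⟩ := (((tendsto_integral_abs_sub_truncation hfQ₀).comp
    tendsto_natCast_atTop_atTop).eventually_lt_const
      (lt_min hc0 (mul_pos hc0 (half_pos hδ0)))).exists
  have hclose : ∀ᶠ i in l, |∫ y, f y ∂Q i - ∫ y, f y ∂Q₀| < c :=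
    (tendsto_iff_dist_tendsto_zero.1 hint).eventually_lt_const hc0
  have hN : ∀ᶠ N : ℕ in atTop, (T : ℝ) ^ 2 / N / c ^ 2 < δ / 2 := by
    have hlim := (tendsto_const_div_atTop_nhds_zero_nat ((T : ℝ) ^ 2)).div_const (c ^ 2)
    rw [zero_div] at hlim
    exact hlim.eventually_lt_const (half_pos hδ0)
  filter_upwards [(hQ.and (hfQ.and (hclose.and ((htail T).eventually_lt_const hT)))).prod_mk
    (hN.and (eventually_ne_atTop 0))] with p ⟨⟨hprob, hfi, hpint, hptail⟩, hpN, hN0⟩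
  rw [lt_min_iff] at hptail
  have hsub : {x | ε ≤ |sampleMean f p.2 x - ∫ y, f y ∂Q₀|} ⊆
      {x | 3 * c ≤ |sampleMean f p.2 x - ∫ y, f y ∂Q p.1|} := fun x hx => by
    have htri := abs_sub_le (sampleMean f p.2 x) (∫ y, f y ∂Q p.1) (∫ y, f y ∂Q₀)
    have hx' : ε ≤ _ := hx
    change 3 * c ≤ _
    linarith
  refine le_trans ?_ hδa
  rw [← ofReal_measureReal]
  refine ENNReal.ofReal_le_ofReal (((measureReal_mono hsub).trans
    (measureReal_le_abs_sampleMean_sub_integral_le_truncation hf hfi T hc0 hN0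
      hptail.1.le)).trans ?_)
  have hrest : (∫ y, |f y - truncation f T y| ∂Q p.1) / c ≤ δ / 2 :=
    (div_le_iff₀' hc0).2 hptail.2.le
  linarith

end WeakLaw

section Normalized

variable {E : Type*} [MeasurableSpace E]

/-- The probability measure proportional to `μ`, for a finite nonzero measure `μ`. The normalizing
factor is that of the average `⨍ x, f x ∂μ`, which is thus the integral of `f` with respect to
`normalized μ`. -/
def normalized (μ : Measure E) : Measure E := (μ Set.univ)⁻¹ • μ

variable {μ : Measure E} {f : E → ℝ}

lemma isProbabilityMeasure_normalized [IsFiniteMeasure μ] (h : μ Set.univ ≠ 0) :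
    IsProbabilityMeasure (normalized μ) :=
  have : NeZero μ := ⟨fun h0 => h (by simp [h0])⟩
  isProbabilityMeasureSMul

lemma integrable_normalized (hf : Integrable f μ) : Integrable f (normalized μ) :=
  hf.to_average

lemma integral_normalized (μ : Measure E) (f : E → ℝ) :
    ∫ x, f x ∂normalized μ = (μ.real Set.univ)⁻¹ * ∫ x, f x ∂μ := average_eq μ f

lemma ae_normalized {p : E → Prop} (h : ∀ᵐ x ∂μ, p x) : ∀ᵐ x ∂normalized μ, p x :=
  Measure.ae_smul_measure h _

lemma normalized_smul {c : ℝ≥0∞} (hc0 : c ≠ 0) (hc : c ≠ ∞) (μ : Measure E) :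
    normalized (c • μ) = normalized μ := by
  rw [normalized, normalized, Measure.smul_apply, smul_smul, smul_eq_mul,
    ENNReal.mul_inv (.inl hc0) (.inl hc), mul_right_comm, ENNReal.inv_mul_cancel hc0 hc, one_mul]

lemma normalized_restrict (μ : Measure E) (S : Set E) :
    normalized (μ.restrict S) = ProbabilityTheory.cond μ S := by
  rw [normalized, Measure.restrict_apply_univ]
  rfl

lemma measure_smul_cond {μ : Measure E} {S : Set E} (hS : μ S ≠ ∞) :
    μ S • ProbabilityTheory.cond μ S = μ.restrict S := by
  rcases eq_or_ne (μ S) 0 with h0 | h0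
  · rw [h0, zero_smul, Measure.restrict_eq_zero.2 h0]
  · rw [ProbabilityTheory.cond, smul_smul, ENNReal.mul_inv_cancel h0 hS, one_smul]

end Normalized

lemma ae_of_ae_condDistrib {Ω Y E : Type*} [MeasurableSpace Ω] [MeasurableSpace Y]
    [MeasurableSpace E] [StandardBorelSpace E] [Nonempty E] {P : Measure Ω} [IsFiniteMeasure P]
    {Z : Ω → Y} {X : Ω → E} (hZ : Measurable Z) (hX : Measurable X) {p : Y × E → Prop}
    (hp : MeasurableSet {q | p q})
    (hae : ∀ᵐ ω ∂P, ∀ᵐ x ∂condDistrib X Z P (Z ω), p (Z ω, x)) : ∀ᵐ ω ∂P, p (Z ω, X ω) := by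
  refine ae_of_ae_map (hZ.prodMk hX).aemeasurable (p := p) ?_
  rw [← compProd_map_condDistrib hX.aemeasurable, Measure.ae_compProd_iff hp]
  have hm : MeasurableSet {y | ∀ᵐ x ∂condDistrib X Z P y, p (y, x)} :=
    Kernel.measurable_kernel_prodMk_left (κ := condDistrib X Z P) hp.compl
      (measurableSet_singleton 0)
  exact (ae_map_iff hZ.aemeasurable hm).2 hae

section Resampling

variable {Y E Ω : Type*} [MeasurableSpace Y] [MeasurableSpace E] [MeasurableSpace Ω]

/-- The kernel that maps a tuple `r` to the sum of the measures that `κ` attaches to its entries. -/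
def pool (κ : Kernel Y E) (M : ℕ) : Kernel (Fin M → Y) E :=
  ∑ i, κ.comap (fun r => r i) (measurable_pi_apply i)

lemma pool_apply (κ : Kernel Y E) {M : ℕ} (r : Fin M → Y) : pool κ M r = ∑ i, κ (r i) := by
  simp_rw [pool, sum_apply, Kernel.comap_apply]

instance (κ : Kernel Y E) [∀ y, IsFiniteMeasure (κ y)] {M : ℕ} (r : Fin M → Y) :
    IsFiniteMeasure (pool κ M r) := by
  rw [pool_apply]; infer_instance

/-- For every `M`, the points `X M j` are drawn independently from the normalized sum of the
measures that a kernel attaches to the first `M` terms of a sequence of independent and identically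
distributed random variables. Nothing is required of the points where this sum vanishes. -/
structure IsResampling [StandardBorelSpace E] [Nonempty E] (κ : Kernel Y E) (ρ : Measure Y)
    (P : Measure Ω) [IsFiniteMeasure P] (ℓ : ℕ → Ω → Y) (X : ℕ → ℕ → Ω → E) : Prop where
  measurable_source : ∀ i, Measurable (ℓ i)
  iIndepFun : iIndepFun ℓ P
  map_eq : ∀ i, P.map (ℓ i) = ρ
  measurable_point : ∀ M j, Measurable (X M j)
  condDistrib_eq : ∀ M, ∀ᵐ r ∂(P.map fun ω (i : Fin M) => ℓ i ω), pool κ M r Set.univ ≠ 0 →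
    condDistrib (fun ω j => X M j ω) (fun ω (i : Fin M) => ℓ i ω) P r =
      Measure.infinitePi fun _ : ℕ => normalized (pool κ M r)

namespace IsResampling

variable [StandardBorelSpace E] [Nonempty E] {κ : Kernel Y E} {ρ : Measure Y} {P : Measure Ω}
  {ℓ : ℕ → Ω → Y} {X : ℕ → ℕ → Ω → E}

/-- The tuple of the first `M` terms of a sequence of random variables. -/
abbrev source (ℓ : ℕ → Ω → Y) (M : ℕ) (ω : Ω) (i : Fin M) : Y := ℓ i ω

section FiniteMeasure

variable [IsFiniteMeasure P]

lemma measurable_sources (h : IsResampling κ ρ P ℓ X) (M : ℕ) : Measurable (source ℓ M) :=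
  measurable_pi_lambda _ fun i => h.measurable_source i

lemma measurable_points (h : IsResampling κ ρ P ℓ X) (M : ℕ) :
    Measurable fun ω j => X M j ω := measurable_pi_lambda _ fun j => h.measurable_point M j

lemma ae_forall_source (h : IsResampling κ ρ P ℓ X) {p : Y → Prop} (hp : ∀ᵐ y ∂ρ, p y) :
    ∀ᵐ ω ∂P, ∀ i, p (ℓ i ω) :=
  ae_all_iff.2 fun i => ae_of_ae_map (h.measurable_source i).aemeasurable (by rwa [h.map_eq])

lemma ae_integrable_pool (h : IsResampling κ ρ P ℓ X) {f : E → ℝ}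
    (hfi : Integrable f (κ ∘ₘ ρ)) : ∀ᵐ ω ∂P, ∀ M, Integrable f (pool κ M (source ℓ M ω)) := by
  filter_upwards [h.ae_forall_source ((Measure.integrable_comp_iff hfi.1).1 hfi).1] with ω hω M
  rw [pool_apply, integrable_finsetSum_measure]
  exact fun i _ => hω i

lemma ae_condDistrib_eq (h : IsResampling κ ρ P ℓ X) :
    ∀ᵐ ω ∂P, ∀ M, pool κ M (source ℓ M ω) Set.univ ≠ 0 →
      condDistrib (fun ω j => X M j ω) (source ℓ M) P (source ℓ M ω) =
        Measure.infinitePi fun _ : ℕ => normalized (pool κ M (source ℓ M ω)) :=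
  ae_all_iff.2 fun M => ae_of_ae_map (h.measurable_sources M).aemeasurable (h.condDistrib_eq M)

lemma ae_of_ae_infinitePi (h : IsResampling κ ρ P ℓ X) {M : ℕ} {p : (Fin M → Y) × (ℕ → E) → Prop}
    (hp : MeasurableSet {q | p q})
    (hae : ∀ᵐ ω ∂P, pool κ M (source ℓ M ω) Set.univ ≠ 0 →
      ∀ᵐ x ∂Measure.infinitePi (fun _ : ℕ => normalized (pool κ M (source ℓ M ω))),
        p (source ℓ M ω, x)) :
    ∀ᵐ ω ∂P, pool κ M (source ℓ M ω) Set.univ ≠ 0 → p (source ℓ M ω, fun j => X M j ω) := by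
  have hpool : MeasurableSet {q : (Fin M → Y) × (ℕ → E) | pool κ M q.1 Set.univ ≠ 0} :=
    ((pool κ M).measurable_coe .univ).comp measurable_fst (measurableSet_singleton 0).compl
  refine ae_of_ae_condDistrib (h.measurable_sources M) (h.measurable_points M)
    (p := fun q => pool κ M q.1 Set.univ ≠ 0 → p q)
    (measurableSet_setOfPred.2
      (.imp (measurableSet_setOfPred.1 hpool) (measurableSet_setOfPred.1 hp))) ?_
  filter_upwards [hae, h.ae_condDistrib_eq] with ω hω hlaw
  by_cases h0 : pool κ M (source ℓ M ω) Set.univ = 0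
  · exact ae_of_all _ fun x hx => absurd h0 hx
  · rw [hlaw M h0]
    filter_upwards [hω h0] with x hx _ using hx

lemma ae_forall_point [∀ y, IsFiniteMeasure (κ y)] (h : IsResampling κ ρ P ℓ X) {p : E → Prop}
    (hp : ∀ᵐ x ∂(κ ∘ₘ ρ), p x) :
    ∀ᵐ ω ∂P, ∀ M, pool κ M (source ℓ M ω) Set.univ ≠ 0 → ∀ j, p (X M j ω) := by
  obtain ⟨W, hW, hWm, hWp⟩ := hp.exists_measurable_mem
  suffices ∀ M, ∀ᵐ ω ∂P, pool κ M (source ℓ M ω) Set.univ ≠ 0 → ∀ j, X M j ω ∈ W by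
    filter_upwards [ae_all_iff.2 this] with ω hω M hM j using hWp _ (hω M hM j)
  intro M
  refine h.ae_of_ae_infinitePi (p := fun q => ∀ j, q.2 j ∈ W) ?_ ?_
  · simp_rw [Set.ofPred_forall]
    exact .iInter fun j => ((measurable_pi_apply j).comp measurable_snd) hWm
  · filter_upwards [h.ae_forall_source (Measure.ae_ae_of_ae_comp hW)] with ω hω h0
    have := isProbabilityMeasure_normalized h0
    have hpool : ∀ᵐ x ∂pool κ M (source ℓ M ω), x ∈ W := by
      rw [pool_apply, ae_finsetSum_measure_iff]
      exact fun i _ => hω i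
    exact ae_all_iff.2 fun j => (measurePreserving_eval_infinitePi _ j).quasiMeasurePreserving.ae
      (ae_normalized hpool)

lemma ae_tendsto_sampleMean [∀ y, IsFiniteMeasure (κ y)] (h : IsResampling κ ρ P ℓ X) {f : E → ℝ}
    (hf : Measurable f) (hfi : Integrable f (κ ∘ₘ ρ)) :
    ∀ᵐ ω ∂P, ∀ M, pool κ M (source ℓ M ω) Set.univ ≠ 0 →
      Tendsto (fun N => sampleMean f N fun j => X M j ω) atTop
        (𝓝 (∫ x, f x ∂normalized (pool κ M (source ℓ M ω)))) := by
  refine ae_all_iff.2 fun M => ?_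
  have hmean : Measurable fun r => ∫ x, f x ∂normalized (pool κ M r) := by
    simp_rw [integral_normalized]
    exact ((pool κ M).measurable_coe .univ).ennreal_toReal.inv.mul
      hf.stronglyMeasurable.integral_kernel.measurable
  refine h.ae_of_ae_infinitePi
    (p := fun q => Tendsto (fun N => sampleMean f N q.2) atTop
      (𝓝 (∫ x, f x ∂normalized (pool κ M q.1))))
    (measurableSet_tendsto_fun (fun N => (measurable_sampleMean hf N).comp measurable_snd)
      (hmean.comp measurable_fst)) ?_
  filter_upwards [h.ae_integrable_pool hfi] with ω hω h0
  have := isProbabilityMeasure_normalized h0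
  exact _root_.ae_tendsto_sampleMean hf (integrable_normalized (hω M))

lemma ae_sampleMean_congr [∀ y, IsFiniteMeasure (κ y)] (h : IsResampling κ ρ P ℓ X) {f g : E → ℝ}
    (hfg : f =ᵐ[κ ∘ₘ ρ] g) :
    ∀ᵐ ω ∂P, ∀ M, pool κ M (source ℓ M ω) Set.univ ≠ 0 → ∀ N,
      sampleMean f N (fun j => X M j ω) = sampleMean g N fun j => X M j ω := by
  filter_upwards [h.ae_forall_point hfg] with ω hω M hM N
  rw [sampleMean, sampleMean, Finset.sum_congr rfl fun j _ => hω M hM j]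

end FiniteMeasure

variable [IsProbabilityMeasure P]

lemma ae_tendsto_sum (h : IsResampling κ ρ P ℓ X) {g : Y → ℝ} (hg : Measurable g)
    (hgi : Integrable g ρ) :
    ∀ᵐ ω ∂P, Tendsto (fun M : ℕ => (∑ i : Fin M, g (ℓ i ω)) / M) atTop (𝓝 (∫ y, g y ∂ρ)) := by
  have hlaw (i : ℕ) : HasLaw (ℓ i) ρ P := ⟨(h.measurable_source i).aemeasurable, h.map_eq i⟩
  have hslln := strong_law_ae_real (fun i ω => g (ℓ i ω))
    (Integrable.comp_measurable (by rwa [h.map_eq]) (h.measurable_source 0))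
    (fun i j hij => (h.iIndepFun.indepFun hij).comp hg hg)
    fun i => ((hlaw i).identDistrib (hlaw 0)).comp hg
  filter_upwards [hslln] with ω hω
  rw [← (hlaw 0).integral_comp hg.aestronglyMeasurable]
  exact hω.congr fun M => by rw [Finset.sum_range]

lemma ae_tendsto_integral_pool (h : IsResampling κ ρ P ℓ X) {f : E → ℝ} (hf : Measurable f)
    (hfi : Integrable f (κ ∘ₘ ρ)) :
    ∀ᵐ ω ∂P, Tendsto (fun M : ℕ => (∫ x, f x ∂pool κ M (source ℓ M ω)) / M) atTop
      (𝓝 (∫ x, f x ∂(κ ∘ₘ ρ))) := by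
  have hg : Measurable fun y => ∫ x, f x ∂κ y := hf.stronglyMeasurable.integral_kernel.measurable
  have hfi' : Integrable f ((κ ∘ₖ Kernel.const Unit ρ) ()) := by
    rwa [← Measure.comp_eq_comp_const_apply]
  have hgi : Integrable (fun y => ∫ x, f x ∂κ y) ρ := hfi'.integral_comp
  have hmean : ∫ x, f x ∂(κ ∘ₘ ρ) = ∫ y, ∫ x, f x ∂κ y ∂ρ := by
    rw [Measure.comp_eq_comp_const_apply, Kernel.integral_comp hfi', Kernel.const_apply]
  filter_upwards [h.ae_tendsto_sum hg hgi,
    h.ae_forall_source ((Measure.integrable_comp_iff hfi.1).1 hfi).1] with ω hω hint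
  rw [hmean]
  exact hω.congr fun M => by
    rw [pool_apply, integral_finsetSum_measure fun (i : Fin M) _ => hint i]

variable [IsFiniteMeasure (κ ∘ₘ ρ)]

lemma ae_tendsto_measureReal_pool (h : IsResampling κ ρ P ℓ X) :
    ∀ᵐ ω ∂P, Tendsto (fun M : ℕ => (pool κ M (source ℓ M ω)).real Set.univ / M) atTop
      (𝓝 ((κ ∘ₘ ρ).real Set.univ)) := by
  simpa only [integral_const, smul_eq_mul, mul_one] using
    h.ae_tendsto_integral_pool (f := fun _ => 1) measurable_const (integrable_const _)

variable [NeZero (κ ∘ₘ ρ)]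

lemma ae_eventually_pool_ne_zero (h : IsResampling κ ρ P ℓ X) :
    ∀ᵐ ω ∂P, ∀ᶠ M in atTop, pool κ M (source ℓ M ω) Set.univ ≠ 0 := by
  filter_upwards [h.ae_tendsto_measureReal_pool] with ω hω
  filter_upwards [hω.eventually_const_lt measureReal_univ_pos] with M hM h0
  simp [measureReal_def, h0] at hM

lemma ae_tendsto_integral_normalized (h : IsResampling κ ρ P ℓ X) {f : E → ℝ} (hf : Measurable f)
    (hfi : Integrable f (κ ∘ₘ ρ)) :
    ∀ᵐ ω ∂P, Tendsto (fun M => ∫ x, f x ∂normalized (pool κ M (source ℓ M ω))) atTop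
      (𝓝 (∫ x, f x ∂normalized (κ ∘ₘ ρ))) := by
  filter_upwards [h.ae_tendsto_integral_pool hf hfi, h.ae_tendsto_measureReal_pool]
    with ω hint hmass
  rw [integral_normalized]
  refine ((hmass.inv₀ measureReal_univ_pos.ne').mul hint).congr' ?_
  filter_upwards [eventually_ne_atTop 0] with M hM
  rw [integral_normalized, inv_div]
  field_simp

lemma tendsto_measure_pool_eq_zero (h : IsResampling κ ρ P ℓ X) :
    Tendsto (fun M => P {ω | pool κ M (source ℓ M ω) Set.univ = 0}) atTop (𝓝 0) := by
  have hm (M : ℕ) : MeasurableSet {ω | pool κ M (source ℓ M ω) Set.univ = 0} :=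
    ((pool κ M).measurable_coe .univ).comp (h.measurable_sources M) (measurableSet_singleton 0)
  suffices Tendsto _ atTop (𝓝 (P ∅)) by rwa [measure_empty] at this
  refine tendsto_measure_of_ae_tendsto_indicator_of_isFiniteMeasure atTop .empty hm ?_
  filter_upwards [h.ae_eventually_pool_ne_zero] with ω hω
  filter_upwards [hω] with M hM
  simpa using hM

lemma tendsto_measure_of_ae_tendsto (h : IsResampling κ ρ P ℓ X) {ι : Type*} {l : Filter ι}
    [l.IsCountablyGenerated] {m : ι → ℕ} (hm : Tendsto m l atTop) {D : ι → Set (ℕ → E)}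
    (hD : ∀ i, MeasurableSet (D i)) {c : ℝ≥0∞}
    (hc : ∀ᵐ ω ∂P, Tendsto (fun i => Measure.infinitePi
      (fun _ : ℕ => normalized (pool κ (m i) (source ℓ (m i) ω))) (D i)) l (𝓝 c)) :
    Tendsto (fun i => P {ω | (fun j => X (m i) j ω) ∈ D i}) l (𝓝 c) := by
  have htotal (i : ι) : P {ω | (fun j => X (m i) j ω) ∈ D i} =
      ∫⁻ ω, condDistrib (fun ω j => X (m i) j ω) (source ℓ (m i)) P (source ℓ (m i) ω) (D i)
        ∂P := by
    have := setLIntegral_preimage_condDistrib (μ := P) (h.measurable_sources (m i))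
      (h.measurable_points (m i)).aemeasurable (hD i) .univ
    rw [Set.preimage_univ, setLIntegral_univ, Set.univ_inter] at this
    exact this.symm
  simp_rw [htotal]
  rw [← mul_one c, ← measure_univ (μ := P), ← lintegral_const]
  refine tendsto_lintegral_filter_of_dominated_convergence (fun _ => 1)
    (.of_forall fun i => ((condDistrib _ _ P).measurable_coe (hD i)).comp (h.measurable_sources _))
    (.of_forall fun i => ae_of_all _ fun ω => prob_le_one) (by simp) ?_
  filter_upwards [hc, h.ae_condDistrib_eq, h.ae_eventually_pool_ne_zero] with ω hω hlaw hpool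
  refine hω.congr' ?_
  filter_upwards [hm.eventually hpool] with i hi
  rw [hlaw _ hi]

variable [∀ y, IsFiniteMeasure (κ y)]

theorem tendsto_measure_point (h : IsResampling κ ρ P ℓ X) (j : ℕ) {B : Set E}
    (hB : MeasurableSet B) :
    Tendsto (fun M => P {ω | X M j ω ∈ B}) atTop (𝓝 (normalized (κ ∘ₘ ρ) B)) := by
  have := isProbabilityMeasure_normalized (NeZero.ne (κ ∘ₘ ρ) ∘ Measure.measure_univ_eq_zero.1)
  refine h.tendsto_measure_of_ae_tendsto (m := id) (D := fun _ => {x | x j ∈ B}) tendsto_id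
    (fun _ => measurable_pi_apply j hB) ?_
  filter_upwards [h.ae_eventually_pool_ne_zero, h.ae_tendsto_integral_normalized
    (f := B.indicator 1) (measurable_one.indicator hB) ((integrable_const (1 : ℝ)).indicator hB)]
    with ω hpool hω
  simp only [integral_indicator_one hB] at hω
  rw [← ofReal_measureReal]
  refine (ENNReal.tendsto_ofReal hω).congr' ?_
  filter_upwards [hpool] with M hM
  have := isProbabilityMeasure_normalized hM
  rw [ofReal_measureReal]
  exact ((measurePreserving_eval_infinitePi (fun _ => normalized (pool κ M (source ℓ M ω)))
    j).measure_preimage hB.nullMeasurableSet).symm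

lemma tendsto_measure_le_abs_sampleMean_sub (h : IsResampling κ ρ P ℓ X) {f : E → ℝ}
    (hf : Measurable f) (hfi : Integrable f (κ ∘ₘ ρ)) {ε : ℝ} (hε : 0 < ε) :
    Tendsto (fun p : ℕ × ℕ => P {ω | ε ≤ |sampleMean f p.2 (fun j => X p.1 j ω) -
      ∫ x, f x ∂normalized (κ ∘ₘ ρ)|}) (atTop ×ˢ atTop) (𝓝 0) := by
  refine h.tendsto_measure_of_ae_tendsto (m := Prod.fst)
    (D := fun p => {x | ε ≤ |sampleMean f p.2 x - ∫ x, f x ∂normalized (κ ∘ₘ ρ)|}) tendsto_fst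
    (fun p => measurableSet_le measurable_const
      ((measurable_sampleMean hf p.2).sub_const _).abs) ?_
  have htail (T : ℕ) : ∀ᵐ ω ∂P, Tendsto
      (fun M => ∫ x, |f x - truncation f T x| ∂normalized (pool κ M (source ℓ M ω))) atTop
      (𝓝 (∫ x, |f x - truncation f T x| ∂normalized (κ ∘ₘ ρ))) :=
    h.ae_tendsto_integral_normalized (hf.sub (measurable_truncation hf T)).abs
      (hfi.sub hfi.1.integrable_truncation).abs
  filter_upwards [h.ae_eventually_pool_ne_zero, h.ae_integrable_pool hfi,
    h.ae_tendsto_integral_normalized hf hfi, ae_all_iff.2 htail] with ω hpool hint hmean hω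
  exact _root_.tendsto_measure_le_abs_sampleMean_sub
    (hpool.mono fun M => isProbabilityMeasure_normalized) hf
    (.of_forall fun M => integrable_normalized (hint M)) (integrable_normalized hfi) hmean hω hε

theorem tendstoInMeasure_sampleMean (h : IsResampling κ ρ P ℓ X) {f : E → ℝ}
    (hfi : Integrable f (κ ∘ₘ ρ)) :
    TendstoInMeasure P (fun (p : ℕ × ℕ) ω => sampleMean f p.2 fun j => X p.1 j ω)
      (atTop ×ˢ atTop) fun _ => ∫ x, f x ∂normalized (κ ∘ₘ ρ) := by
  obtain ⟨g, hg, hfg⟩ := hfi.1.aemeasurable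
  rw [integral_congr_ae (ae_normalized hfg), tendstoInMeasure_iff_norm]
  intro ε hε
  have hlim := (h.tendsto_measure_le_abs_sampleMean_sub hg (hfi.congr hfg) hε).add
    (h.tendsto_measure_pool_eq_zero.comp (tendsto_fst (g := (atTop : Filter ℕ))))
  rw [add_zero] at hlim
  refine tendsto_of_tendsto_of_tendsto_of_le_of_le tendsto_const_nhds hlim (fun _ => zero_le)
    fun p => (measure_mono_ae ?_).trans (measure_union_le _ _)
  filter_upwards [h.ae_sampleMean_congr hfg] with ω hω hmem
  refine or_iff_not_imp_right.2 fun h0 => ?_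
  change ε ≤ |_|
  rw [← hω p.1 h0]
  exact hmem

theorem ae_exists_tendsto_sampleMean (h : IsResampling κ ρ P ℓ X) {f : E → ℝ}
    (hfi : Integrable f (κ ∘ₘ ρ)) :
    ∀ᵐ ω ∂P, ∃ I : ℕ → ℝ,
      (∀ᶠ M in atTop, Tendsto (fun N => sampleMean f N fun j => X M j ω) atTop (𝓝 (I M))) ∧
      Tendsto I atTop (𝓝 (∫ x, f x ∂normalized (κ ∘ₘ ρ))) := by
  obtain ⟨g, hg, hfg⟩ := hfi.1.aemeasurable
  have hgi := hfi.congr hfg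
  rw [integral_congr_ae (ae_normalized hfg)]
  filter_upwards [h.ae_sampleMean_congr hfg, h.ae_tendsto_sampleMean hg hgi,
    h.ae_eventually_pool_ne_zero, h.ae_tendsto_integral_normalized hg hgi]
    with ω hcongr hsample hpool hlim
  refine ⟨_, hpool.mono fun M hM => ?_, hlim⟩
  exact (hsample M hM).congr fun N => (hcongr M hM N).symm

end IsResampling

end Resampling

section SequenceLaws

variable {E : Type*} [MeasurableSpace E]

lemma measurable_restrict_fin (N : ℕ) : Measurable fun (x : ℕ → E) (j : Fin N) => x j :=
  measurable_pi_lambda _ fun j => measurable_pi_apply (j : ℕ)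

lemma ext_of_map_restrict_fin {μ ν : Measure (ℕ → E)} [IsFiniteMeasure ν]
    (h : ∀ N, μ.map (fun x (j : Fin N) => x j) = ν.map fun x (j : Fin N) => x j) : μ = ν := by
  refine IsProjectiveLimit.unique (P := fun I => ν.map I.restrict) (fun I => ?_) fun _ => rfl
  obtain ⟨N, hN⟩ := I.exists_nat_subset_range
  let restr (y : Fin N → E) (i : I) : E := y ⟨i, Finset.mem_range.1 (hN i.2)⟩
  have hrestr : Measurable restr := measurable_pi_lambda _ fun i => measurable_pi_apply _
  have hcomp : I.restrict = restr ∘ fun (x : ℕ → E) (j : Fin N) => x j := rfl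
  calc μ.map I.restrict = (μ.map fun x (j : Fin N) => x j).map restr := by
        rw [hcomp, Measure.map_map hrestr (measurable_restrict_fin N)]
    _ = (ν.map fun x (j : Fin N) => x j).map restr := by rw [h]
    _ = ν.map I.restrict := by rw [hcomp, Measure.map_map hrestr (measurable_restrict_fin N)]

lemma map_restrict_fin_infinitePi (Q : Measure E) [IsProbabilityMeasure Q] (N : ℕ) :
    (Measure.infinitePi fun _ : ℕ => Q).map (fun x (j : Fin N) => x j) =
      Measure.pi fun _ => Q := by
  have hindep : iIndepFun (fun (j : Fin N) (x : ℕ → E) => x j)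
      (Measure.infinitePi fun _ : ℕ => Q) :=
    (iIndepFun_infinitePi (P := fun _ : ℕ => Q) (X := fun _ x => x)
      fun _ => measurable_id).precomp Fin.val_injective
  calc (Measure.infinitePi fun _ : ℕ => Q).map (fun x (j : Fin N) => x j) =
        Measure.pi fun j : Fin N => (Measure.infinitePi fun _ : ℕ => Q).map fun x => x j :=
        iIndepFun.map_fun_eq_pi_map (f := fun (j : Fin N) (x : ℕ → E) => x j)
          (fun j => (measurable_pi_apply (j : ℕ)).aemeasurable) hindep
    _ = Measure.pi fun _ => Q := by
        congr 1 with j : 1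
        exact Measure.infinitePi_map_eval (fun _ : ℕ => Q) j

lemma ae_condDistrib_eq_infinitePi_map {Ω Y F : Type*} [MeasurableSpace Ω] [MeasurableSpace Y]
    [MeasurableSpace F] [StandardBorelSpace F] [Nonempty F] [StandardBorelSpace E] [Nonempty E]
    {P : Measure Ω} [IsFiniteMeasure P] {Z : Ω → Y} {V : ℕ → Ω → F} (hV : ∀ j, Measurable (V j))
    {g : F → E} (hg : Measurable g) {p : Y → Prop} {Q : Y → Measure F}
    (hQ : ∀ y, p y → IsProbabilityMeasure (Q y))
    (h : ∀ N, ∀ᵐ y ∂P.map Z, p y →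
      condDistrib (fun ω (j : Fin N) => V j ω) Z P y = Measure.pi fun _ => Q y) :
    ∀ᵐ y ∂P.map Z, p y → condDistrib (fun ω j => g (V j ω)) Z P y =
      Measure.infinitePi fun _ : ℕ => (Q y).map g := by
  have hgs (N : ℕ) : Measurable fun (v : Fin N → F) j => g (v j) :=
    measurable_pi_lambda _ fun j => hg.comp (measurable_pi_apply j)
  have hmarginal : ∀ᵐ y ∂P.map Z, ∀ N : ℕ,
      (condDistrib (fun ω j => g (V j ω)) Z P y).map (fun x (j : Fin N) => x j) =
        (condDistrib (fun ω (j : Fin N) => V j ω) Z P y).map fun v j => g (v j) := by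
    refine ae_all_iff.2 fun N => ?_
    filter_upwards [
      condDistrib_comp (μ := P) Z
        (measurable_pi_lambda (fun ω j => g (V j ω)) fun j => hg.comp (hV j)).aemeasurable
        (measurable_restrict_fin N),
      condDistrib_comp (μ := P) Z
        (measurable_pi_lambda (fun ω (j : Fin N) => V j ω) fun j => hV j).aemeasurable
        (hgs N)] with y hseq hfin
    rw [← Kernel.map_apply _ (measurable_restrict_fin N), ← Kernel.map_apply _ (hgs N), ← hseq,
      ← hfin]
    rfl
  filter_upwards [hmarginal, ae_all_iff.2 h] with y hy hlaw hp
  have := hQ y hp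
  have : IsProbabilityMeasure ((Q y).map g) := Measure.isProbabilityMeasure_map hg.aemeasurable
  refine ext_of_map_restrict_fin fun N => ?_
  rw [hy, hlaw N hp, map_restrict_fin_infinitePi]
  exact Measure.pi_map_pi fun _ => hg.aemeasurable

end SequenceLaws

namespace Ray

section CrossingKernel

variable {S B : Set E3}

lemma crossing_eq_zero {l : Ray} (h : l ∉ hits B) : crossing B l = 0 := by
  rw [crossing, Set.not_nonempty_iff_eq_empty.1 h, Measure.restrict_empty, ite_self]

/-- The counting measures on the intersections of the rays with a set, as a kernel. -/
def crossingKernel (hB : IsSigmaCompact B) : Kernel Ray E3 := ⟨crossing B, measurable_crossing hB⟩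

instance (hB : IsSigmaCompact B) (l : Ray) : IsFiniteMeasure (crossingKernel hB l) :=
  inferInstanceAs (IsFiniteMeasure (crossing B l))

lemma crossingKernel_comp_cond (hB : IsSigmaCompact B) {L : Set Ray} (hBL : hits B ⊆ L) :
    crossingKernel hB ∘ₘ ProbabilityTheory.cond Ray.measure L =
      (Ray.measure L)⁻¹ • Ray.measure.bind (crossing B) := by
  have hm := measurableSet_hits hB
  ext C hC
  have hcross : (hits B).indicator (fun l => crossing B l C) = fun l => crossing B l C :=
    Set.indicator_eq_self.2 fun l hl => by_contra fun hmiss => hl (by simp [crossing_eq_zero hmiss])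
  rw [ProbabilityTheory.cond, Measure.comp_smul, Measure.smul_apply, Measure.smul_apply]
  congr 1
  calc (crossingKernel hB ∘ₘ Ray.measure.restrict L) C = ∫⁻ l in L, crossing B l C ∂(Ray.measure) :=
        Measure.bind_apply hC (crossingKernel hB).aemeasurable
    _ = ∫⁻ l in hits B, crossing B l C ∂(Ray.measure) := by
        rw [← hcross, lintegral_indicator hm, lintegral_indicator hm,
          Measure.restrict_restrict hm, Measure.restrict_restrict hm, Set.inter_self,
          Set.inter_eq_left.2 hBL]
    _ = Ray.measure.bind (crossing B) C := by
        rw [← lintegral_indicator hm, hcross,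
          Measure.bind_apply hC (measurable_crossing hB).aemeasurable]

variable (hS : IsSurface S) (hB : IsSigmaCompactCore surfaceMeasure S B)
include hS hB

lemma ae_crossing_eq : ∀ᵐ l ∂(Ray.measure), (l.points ∩ S).Finite ∧
    crossing B l = Measure.count.restrict (l.points ∩ S) := by
  filter_upwards [ae_hitCount_ne_top hB.isSigmaCompact (surfaceMeasure_core_ne_top hS hB),
    measure_eq_zero_iff_ae_notMem.1 (measure_hits_eq_zero hB.measure_sdiff_eq_zero)]
    with l hfin hmiss
  have heq : l.points ∩ S = l.points ∩ B := by
    refine Set.Subset.antisymm (fun x hx => ⟨hx.1, ?_⟩) (Set.inter_subset_inter_right _ hB.subset)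
    by_contra hxB
    exact hmiss ⟨x, hx.1, hx.2, hxB⟩
  rw [heq, crossing, if_neg hfin]
  exact ⟨Measure.count_apply_lt_top.1 hfin.lt_top, rfl⟩

lemma exists_crossingKernel_comp_cond_eq {L : Set Ray} (hSL : hits S ⊆ L)
    (hL0 : Ray.measure L ≠ 0) (hLtop : Ray.measure L ≠ ∞) : ∃ c : ℝ≥0∞, c ≠ 0 ∧ c ≠ ∞ ∧
    crossingKernel hB.isSigmaCompact ∘ₘ ProbabilityTheory.cond Ray.measure L =
      c • surfaceMeasure.restrict S := by
  refine ⟨(Ray.measure L)⁻¹ * croftonConst,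
    mul_ne_zero (ENNReal.inv_ne_zero.2 hLtop) croftonConst_ne_zero,
    ENNReal.mul_ne_top (ENNReal.inv_ne_top.2 hL0) croftonConst_ne_top, ?_⟩
  rw [crossingKernel_comp_cond _ ((hits_mono hB.subset).trans hSL),
    bind_crossing_eq_croftonConst_smul hS hB, smul_smul]

end CrossingKernel

lemma numHits_eq_count {S : Set E3} {l : Ray} (h : (l.points ∩ S).Finite) :
    (numHits S l : ℝ≥0∞) = Measure.count (l.points ∩ S) := by
  rw [numHits, Measure.count_apply_finite _ h, Set.ncard_eq_toFinset_card _ h]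

end Ray

section Resample

variable {S : Set E3} {M : ℕ} {r : Fin M → Ray}

lemma map_snd_resampleLaw_eq_sum (S : Set E3) (r : Fin M → Ray) :
    (resampleLaw S r).map Prod.snd = (∑ i, (Ray.numHits S (r i) : ℝ≥0∞))⁻¹ •
      ∑ i, (Ray.numHits S (r i) : ℝ≥0∞) • uniformOn ((r i).points ∩ S) := by
  rw [resampleLaw, Measure.map_finset_sum' measurable_snd.aemeasurable, Finset.smul_sum]
  refine Finset.sum_congr rfl fun i _ => ?_
  rw [Measure.map_smul, Measure.map_snd_prod, measure_univ, one_smul, smul_smul,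
    ENNReal.div_eq_inv_mul]

lemma numHits_mul_uniformOn_univ (S : Set E3) (l : Ray) :
    (Ray.numHits S l : ℝ≥0∞) * uniformOn (l.points ∩ S) Set.univ = Ray.numHits S l := by
  rcases eq_or_ne (Ray.numHits S l) 0 with h0 | h0
  · simp [h0]
  · have := isProbabilityMeasure_uniformOn (Set.finite_of_ncard_ne_zero h0)
      (Set.nonempty_of_ncard_ne_zero h0)
    rw [measure_univ, mul_one]

lemma isProbabilityMeasure_resampleLaw (h : ∑ i, Ray.numHits S (r i) ≠ 0) :
    IsProbabilityMeasure (resampleLaw S r) := by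
  have h0 : ∑ i, (Ray.numHits S (r i) : ℝ≥0∞) ≠ 0 := mod_cast h
  have htop : ∑ i, (Ray.numHits S (r i) : ℝ≥0∞) ≠ ∞ := by simp
  constructor
  rw [← Set.preimage_univ (f := Prod.snd), ← Measure.map_apply measurable_snd .univ,
    map_snd_resampleLaw_eq_sum, Measure.smul_apply, Measure.finsetSum_apply]
  simp_rw [Measure.smul_apply, smul_eq_mul, numHits_mul_uniformOn_univ]
  exact ENNReal.inv_mul_cancel h0 htop

variable {B : Set E3} (hB : IsSigmaCompact B)
  (hr : ∀ i, ((r i).points ∩ S).Finite ∧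
    Ray.crossing B (r i) = Measure.count.restrict ((r i).points ∩ S))
include hr

lemma pool_crossingKernel_eq_sum : pool (Ray.crossingKernel hB) M r =
    ∑ i, (Ray.numHits S (r i) : ℝ≥0∞) • uniformOn ((r i).points ∩ S) := by
  rw [pool_apply]
  refine Finset.sum_congr rfl fun i _ => ?_
  rw [Ray.numHits_eq_count (hr i).1, uniformOn,
    measure_smul_cond (Measure.count_apply_lt_top.2 (hr i).1).ne]
  exact (hr i).2

lemma pool_crossingKernel_univ :
    pool (Ray.crossingKernel hB) M r Set.univ = ∑ i, (Ray.numHits S (r i) : ℝ≥0∞) := by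
  rw [pool_crossingKernel_eq_sum hB hr, Measure.finsetSum_apply]
  simp_rw [Measure.smul_apply, smul_eq_mul, numHits_mul_uniformOn_univ]

lemma map_snd_resampleLaw :
    (resampleLaw S r).map Prod.snd = normalized (pool (Ray.crossingKernel hB) M r) := by
  rw [normalized, pool_crossingKernel_univ hB hr, pool_crossingKernel_eq_sum hB hr,
    map_snd_resampleLaw_eq_sum]

end Resample

lemma isResampling_crossingKernel {S B : Set E3} (hS : IsSurface S)
    (hB : IsSigmaCompactCore surfaceMeasure S B) {L : Set Ray}
    {Ω : Type*} [MeasurableSpace Ω] {P : Measure Ω} [IsProbabilityMeasure P]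
    {ℓ : ℕ → Ω → Ray} (hℓ : ∀ i, Measurable (ℓ i)) (hindep : iIndepFun ℓ P)
    (hunif : ∀ i, pdf.IsUniform (ℓ i) L P Ray.measure)
    {R : ℕ → ℕ → Ω → Ray} (hR : ∀ M j, Measurable (R M j))
    {X : ℕ → ℕ → Ω → E3} (hX : ∀ M j, Measurable (X M j))
    (hresample : ∀ M N : ℕ, ∀ᵐ r ∂(P.map fun ω (i : Fin M) => ℓ i ω),
      (∑ i, Ray.numHits S (r i)) ≠ 0 →
        condDistrib (fun ω (j : Fin N) => (R M j ω, X M j ω)) (fun ω (i : Fin M) => ℓ i ω) P r =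
          Measure.pi fun _ : Fin N => resampleLaw S r) :
    IsResampling (Ray.crossingKernel hB.isSigmaCompact) (ProbabilityTheory.cond Ray.measure L) P
      ℓ X where
  measurable_source := hℓ
  iIndepFun := hindep
  map_eq := hunif
  measurable_point := hX
  condDistrib_eq M := by
    have hsource : Measurable fun ω (i : Fin M) => ℓ i ω := measurable_pi_lambda _ fun i => hℓ i
    have hgood : ∀ᵐ r ∂(P.map fun ω (i : Fin M) => ℓ i ω), ∀ i, ((r i).points ∩ S).Finite ∧
        Ray.crossing B (r i) = Measure.count.restrict ((r i).points ∩ S) := by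
      refine ae_all_iff.2 fun i => ae_of_ae_map (f := fun r : Fin M → Ray => r i)
        (p := fun l => (l.points ∩ S).Finite ∧
          Ray.crossing B l = Measure.count.restrict (l.points ∩ S))
        (measurable_pi_apply i).aemeasurable ?_
      rw [Measure.map_map (measurable_pi_apply i) hsource]
      exact (hunif i).absolutelyContinuous.ae_le (Ray.ae_crossing_eq hS hB)
    filter_upwards [hgood, ae_condDistrib_eq_infinitePi_map
      (fun j => (hR M j).prodMk (hX M j)) measurable_snd
      (fun r hr => isProbabilityMeasure_resampleLaw hr) (hresample M)] with r hr hlaw hpool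
    rw [← map_snd_resampleLaw hB.isSigmaCompact hr]
    refine hlaw fun hsum => hpool ?_
    rw [pool_crossingKernel_univ _ hr, ← Nat.cast_sum, hsum, Nat.cast_zero]

lemma measure_ne_zero_and_ne_top_of_isUniform {Ω E : Type*} [MeasurableSpace Ω]
    [MeasurableSpace E] {P : Measure Ω} [IsProbabilityMeasure P] {μ : Measure E} {X : Ω → E}
    {L : Set E} (hX : AEMeasurable X P) (h : pdf.IsUniform X L P μ) : μ L ≠ 0 ∧ μ L ≠ ∞ := by
  have htotal : (μ L)⁻¹ * μ L = 1 := by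
    rw [← (Measure.isProbabilityMeasure_map hX).measure_univ, h, ProbabilityTheory.cond,
      Measure.smul_apply, Measure.restrict_apply_univ, smul_eq_mul]
  exact ⟨fun h0 => by simp [h0] at htotal, fun htop => by simp [htop] at htotal⟩

lemma uniformEstimator_eq_sampleMean (S : Set E3) (f : E3 → ℝ) (x : ℕ → E3) (N : ℕ) :
    uniformEstimator S f x N = sampleMean (fun y => area S * f y) N x := by
  rw [uniformEstimator, sampleMean, one_div, inv_mul_eq_div]

namespace IsSurface

variable {S : Set E3} (hS : IsSurface S)
include hS

lemma cond_surfaceMeasure_apply (B : Set E3) :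
    ProbabilityTheory.cond surfaceMeasure S B = surfaceMeasure (B ∩ S) / surfaceMeasure S := by
  rw [cond_apply hS.measurableSet, ENNReal.div_eq_inv_mul, Set.inter_comm]

lemma integral_cond_surfaceMeasure (f : E3 → ℝ) :
    ∫ x, area S * f x ∂ProbabilityTheory.cond surfaceMeasure S =
      ∫ x in S, f x ∂surfaceMeasure := by
  have harea : area S ≠ 0 := (ENNReal.toReal_pos hS.area_pos.ne' hS.area_lt_top.ne).ne'
  rw [integral_const_mul, ← normalized_restrict, integral_normalized,
    measureReal_restrict_apply_univ]
  exact mul_inv_cancel_left₀ harea _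

end IsSurface

end

theorem mainTheorem1_general
    (S : Set E3) (hS : IsSurface S)
    (L : Set Ray) (hSL : ∀ l : Ray, (l.points ∩ S).Nonempty → l ∈ L)
    {Ω : Type*} [MeasurableSpace Ω] (P : Measure Ω) [IsProbabilityMeasure P]
    (ℓ : ℕ → Ω → Ray) (hℓ : ∀ i, Measurable (ℓ i)) (hindep : iIndepFun ℓ P)
    (hunif : ∀ i, pdf.IsUniform (ℓ i) L P Ray.measure)
    (R : ℕ → ℕ → Ω → Ray) (hR : ∀ M j, Measurable (R M j))
    (X : ℕ → ℕ → Ω → E3) (hX : ∀ M j, Measurable (X M j))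
    (hresample : ∀ M N : ℕ, ∀ᵐ r ∂(P.map fun ω (i : Fin M) => ℓ i ω),
      (∑ i, Ray.numHits S (r i)) ≠ 0 →
        condDistrib (fun ω (j : Fin N) => (R M j ω, X M j ω)) (fun ω (i : Fin M) => ℓ i ω) P r =
          Measure.pi fun _ : Fin N => resampleLaw S r) :
    (∀ (j : ℕ) (B : Set E3), MeasurableSet B →
      Tendsto (fun M => P {ω | X M j ω ∈ B}) atTop
        (𝓝 (surfaceMeasure (B ∩ S) / surfaceMeasure S))) ∧
    ∀ f : E3 → ℝ, IntegrableOn f S surfaceMeasure →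
      TendstoInMeasure P
        (fun (p : ℕ × ℕ) ω => uniformEstimator S f (fun j => X p.1 j ω) p.2) (atTop ×ˢ atTop)
        (fun _ => ∫ x in S, f x ∂surfaceMeasure) ∧
      ∀ᵐ ω ∂P, ∃ I : ℕ → ℝ,
        (∀ᶠ M in atTop, Tendsto (fun N => uniformEstimator S f (fun j => X M j ω) N) atTop
          (𝓝 (I M))) ∧
        Tendsto I atTop (𝓝 (∫ x in S, f x ∂surfaceMeasure)) := by
  obtain ⟨B, hB⟩ := hS.exists_isSigmaCompactCore
  obtain ⟨hL0, hLtop⟩ := measure_ne_zero_and_ne_top_of_isUniform (hℓ 0).aemeasurable (hunif 0)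
  obtain ⟨c, hc0, hc, hcomp⟩ := Ray.exists_crossingKernel_comp_cond_eq hS hB hSL hL0 hLtop
  set ν := Ray.crossingKernel hB.isSigmaCompact ∘ₘ ProbabilityTheory.cond Ray.measure L
  have : IsFiniteMeasure (surfaceMeasure.restrict S) :=
    isFiniteMeasure_restrict.2 hS.area_lt_top.ne
  have : IsFiniteMeasure ν := hcomp ▸ Measure.smul_finite _ hc
  have : NeZero ν :=
    ⟨Measure.measure_univ_ne_zero.1 (by simpa [hcomp, hc0] using hS.area_pos.ne')⟩
  have hν : normalized ν = ProbabilityTheory.cond surfaceMeasure S := by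
    rw [hcomp, normalized_smul hc0 hc, normalized_restrict]
  have hresampling := isResampling_crossingKernel hS hB hℓ hindep hunif hR hX hresample
  refine ⟨fun j C hC => ?_, fun f hf => ?_⟩
  · rw [← hS.cond_surfaceMeasure_apply, ← hν]
    exact hresampling.tendsto_measure_point j hC
  · have hint : Integrable (fun y => area S * f y) ν :=
      hcomp ▸ (Integrable.const_mul hf _).smul_measure hc
    simp_rw [uniformEstimator_eq_sampleMean, ← hS.integral_cond_surfaceMeasure f, ← hν]
    exact ⟨hresampling.tendstoInMeasure_sampleMean hint,
      hresampling.ae_exists_tendsto_sampleMean hint⟩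

theorem mainTheorem1
    (S : Set E3) (hS : IsSurface S)
    -- a compact set of rays that contains all rays meeting `S`
    (L : Set Ray) (hL : IsCompact L) (hSL : ∀ l : Ray, (l.points ∩ S).Nonempty → l ∈ L)
    {Ω : Type*} [MeasurableSpace Ω] (P : Measure Ω) [IsProbabilityMeasure P]
    -- independent rays, uniformly distributed in `L`
    (ℓ : ℕ → Ω → Ray) (hℓ : ∀ i, Measurable (ℓ i)) (hindep : iIndepFun ℓ P)
    (hunif : ∀ i, pdf.IsUniform (ℓ i) L P Ray.measure)
    -- `R M j` and `X M j`: the `j`-th ray resampled from the first `M` rays, and the intersection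
    -- of this ray with `S` that is selected
    (R : ℕ → ℕ → Ω → Ray) (hR : ∀ M j, Measurable (R M j))
    (X : ℕ → ℕ → Ω → E3) (hX : ∀ M j, Measurable (X M j))
    -- given the first `M` rays, not all of which miss `S`, the first `N` pairs are independent with
    -- the law of the resampling step
    (hresample : ∀ M N : ℕ, ∀ᵐ r ∂(P.map fun ω (i : Fin M) => ℓ i ω),
      (∑ i, Ray.numHits S (r i)) ≠ 0 →
        condDistrib (fun ω (j : Fin N) => (R M j ω, X M j ω)) (fun ω (i : Fin M) => ℓ i ω) P r =
          Measure.pi fun _ : Fin N => resampleLaw S r) :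
    -- the points are asymptotically uniformly distributed on `S`
    (∀ (j : ℕ) (B : Set E3), MeasurableSet B →
      Tendsto (fun M => P {ω | X M j ω ∈ B}) atTop
        (𝓝 (surfaceMeasure (B ∩ S) / surfaceMeasure S))) ∧
    ∀ f : E3 → ℝ, IntegrableOn f S surfaceMeasure →
      -- the estimator is consistent: it converges in probability as `M, N → ∞`
      TendstoInMeasure P
        (fun (p : ℕ × ℕ) ω => uniformEstimator S f (fun j => X p.1 j ω) p.2) (atTop ×ˢ atTop)
        (fun _ => ∫ x in S, f x ∂surfaceMeasure) ∧
      -- almost surely it converges as `N → ∞` for all large `M`, and the limit tends to the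
      -- integral as `M → ∞`
      ∀ᵐ ω ∂P, ∃ I : ℕ → ℝ,
        (∀ᶠ M in atTop, Tendsto (fun N => uniformEstimator S f (fun j => X M j ω) N) atTop
          (𝓝 (I M))) ∧
        Tendsto I atTop (𝓝 (∫ x in S, f x ∂surfaceMeasure)) :=
  mainTheorem1_general S hS L hSL P ℓ hℓ hindep hunif R hR X hX hresample
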